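/- Let $\nu>0$ and $f\in\mathbb{R}$, and write $(x,y,z)$ for the coordinates of $\mathbb{R}^3$. For $u\in L^2(\mathbb{R}^3)=L^2(\mathbb{R}^3;\mathbb{C})$ let $\Delta u$ and $y\,\partial_x u$ be understood in the sense of (tempered) distributions, and for $j,k\in\{x,y,z\}$ let $\Delta^{-1}\partial_{jk}$ be the bounded operator on $L^2(\mathbb{R}^3)$ given by the Fourier multiplier $\xi_j\xi_k/|\xi|^2$. On $[L^2(\mathbb{R}^3)]^3$ define the operator $$ \mathscr{L}=(\nu\Delta-y\,\partial_x)\,I_3+ \begin{pmatrix} f\Delta^{-1}\partial_{xy} & f-1+(2-f)\Delta^{-1}\partial_x^2 & 0\\ -f+f\Delta^{-1}\partial_y^2 & (2-f)\Delta^{-1}\partial_{xy} & 0\\ f\Delta^{-1}\partial_{yz} & (2-f)\Delta^{-1}\partial_{xz} & 0 \end{pmatrix} $$ with domain $$ \mathcal{D}(\mathscr{L})=\bigl\{\mathbf{u}\in[L^2(\mathbb{R}^3)]^3 \;:\; \nu\Delta\mathbf{u}\in[L^2(\mathbb{R}^3)]^3 \text{ and } y\,\partial_x\mathbf{u}\in[L^2(\mathbb{R}^3)]^3\bigr\}.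 $$ Then $\mathscr{L}$ is a closed operator, and it generates a $C_0$-semigroup on $[L^2(\mathbb{R}^3)]^3$: there is a strongly continuous semigroup $(S(t))_{t\ge 0}$ of bounded linear operators on $[L^2(\mathbb{R}^3)]^3$ whose infinitesimal generator (with its exact domain) is $\mathscr{L}$. -/

import Mathlib

open MeasureTheory Filter Topology
open scoped ENNReal NNReal SchwartzMap FourierTransform LineDeriv Laplacian

noncomputable section

namespace CouetteCoriolis

/-- Physical space `ℝ³`; the coordinates `x, y, z` have the indices `0, 1, 2`. -/
abbrev Space : Type := EuclideanSpace ℝ (Fin 3)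

/-- The complex Hilbert space `L²(ℝ³)`. -/
abbrev L2 : Type := Lp ℂ 2 (volume : Measure Space)

/-- The complex Hilbert space `[L²(ℝ³)]³`, with `‖u‖² = ∑ i, ‖u i‖²`. -/
abbrev L2Vec : Type := PiLp 2 (fun _ : Fin 3 => L2)

/-! ### Differential operators on `L²(ℝ³)` with their maximal domains -/

/-- The embedding of `L²(ℝ³)` into the tempered distributions. -/
def toDistr : L2 →ₗ[ℂ] 𝓢'(Space, ℂ) :=
  (Lp.toTemperedDistributionCLM ℂ (volume : Measure Space) 2 : L2 →L[ℂ] 𝓢'(Space, ℂ))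

theorem toDistr_injective : Function.Injective toDistr := by
  rw [← LinearMap.ker_eq_bot]
  exact Lp.ker_toTemperedDistributionCLM_eq_bot

/-- For a linear map `T` from `L²(ℝ³)` to the tempered distributions: the operator in `L²(ℝ³)`
with domain `{u ∈ L² | T u ∈ L²}` that acts on it as `T`. -/
def realization (T : L2 →ₗ[ℂ] 𝓢'(Space, ℂ)) : L2 →ₗ.[ℂ] L2 where
  domain := (LinearMap.range toDistr).comap T
  toFun := (LinearEquiv.ofInjective toDistr toDistr_injective).symm.toLinearMap ∘ₗ
    (T.domRestrict ((LinearMap.range toDistr).comap T)).codRestrict (LinearMap.range toDistr)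
      (fun u => u.2)

theorem mem_realization_domain (T : L2 →ₗ[ℂ] 𝓢'(Space, ℂ)) (u : L2) :
    u ∈ (realization T).domain ↔ ∃ v : L2, toDistr v = T u := Iff.rfl

theorem toDistr_realization (T : L2 →ₗ[ℂ] 𝓢'(Space, ℂ)) (u : (realization T).domain) :
    toDistr (realization T u) = T u := by
  have h := LinearEquiv.apply_symm_apply (LinearEquiv.ofInjective toDistr toDistr_injective)
    ((T.domRestrict ((LinearMap.range toDistr).comap T)).codRestrict (LinearMap.range toDistr)
      (fun u => u.2) u)
  exact congrArg Subtype.val h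

/-- The distributional Laplacian of an `L²` function. -/
def laplacianDistr : L2 →ₗ[ℂ] 𝓢'(Space, ℂ) where
  toFun u := Δ (toDistr u)
  map_add' u v := by
    simp only [← TemperedDistribution.laplacianCLM_apply, map_add]
  map_smul' c u := by
    simp only [← TemperedDistribution.laplacianCLM_apply, map_smul, RingHom.id_apply]

/-- The coordinate unit vector in the direction of `x`. -/
def ex : Space := EuclideanSpace.single 0 1

/-- The distribution `y ∂ₓ u` for an `L²` function `u`. -/
def shearDistr : L2 →ₗ[ℂ] 𝓢'(Space, ℂ) where
  toFun u := TemperedDistribution.smulLeftCLM ℂ (fun p : Space => ((p 1 : ℝ) : ℂ))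
    (∂_{ex} (toDistr u))
  map_add' u v := by
    simp only [LineDerivAdd.lineDerivOp_add, map_add]
  map_smul' c u := by
    simp only [map_smul, LineDerivSMul.lineDerivOp_smul, RingHom.id_apply]

/-- The scalar operator `ν Δ - y ∂ₓ`, with domain `{u ∈ L² | Δ u ∈ L², y ∂ₓ u ∈ L²}`. -/
def scalarOp (ν : ℝ) : L2 →ₗ.[ℂ] L2 :=
  (ν : ℂ) • realization laplacianDistr - realization shearDistr

/-- An operator in `L²(ℝ³)` applied to each of the three components of `u ∈ [L²(ℝ³)]³`. -/
def diagOp (A : L2 →ₗ.[ℂ] L2) : L2Vec →ₗ.[ℂ] L2Vec where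
  domain :=
    { carrier := {u | ∀ i, u i ∈ A.domain}
      add_mem' := fun hu hv i => A.domain.add_mem (hu i) (hv i)
      zero_mem' := fun _ => A.domain.zero_mem
      smul_mem' := fun c _ hu i => A.domain.smul_mem c (hu i) }
  toFun :=
    { toFun := fun u => WithLp.toLp 2 (fun i => A ⟨u.1 i, u.2 i⟩)
      map_add' := fun u v => by
        ext1 i
        exact A.map_add ⟨u.1 i, u.2 i⟩ ⟨v.1 i, v.2 i⟩
      map_smul' := fun c u => by
        ext1 i
        exact A.map_smul c ⟨u.1 i, u.2 i⟩ }

/-! ### The bounded zero-order part -/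

/-- The symbol `ξⱼ ξₖ / |ξ|²` of `Δ⁻¹ ∂ⱼ ∂ₖ` (its value at `ξ = 0` is immaterial). -/
def rieszSymbol (j k : Fin 3) (ξ : Space) : ℂ := ((ξ j * ξ k / ‖ξ‖ ^ 2 : ℝ) : ℂ)

theorem memLp_rieszSymbol (j k : Fin 3) :
    MemLp (rieszSymbol j k) ∞ (volume : Measure Space) := by
  refine memLp_top_of_bound ?_ 1 (ae_of_all _ fun ξ => ?_)
  · unfold rieszSymbol
    exact Measurable.aestronglyMeasurable (by fun_prop)
  · have hj : |ξ j| ≤ ‖ξ‖ := by simpa using PiLp.norm_apply_le ξ j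
    have hk : |ξ k| ≤ ‖ξ‖ := by simpa using PiLp.norm_apply_le ξ k
    rw [rieszSymbol, Complex.norm_real, Real.norm_eq_abs, abs_div, abs_mul,
      abs_of_nonneg (sq_nonneg ‖ξ‖), sq]
    exact div_le_one_of_le₀ (mul_le_mul hj hk (abs_nonneg _) (norm_nonneg _)) (by positivity)

/-- `Δ⁻¹ ∂ⱼ ∂ₖ` on `L²(ℝ³)`, that is, the Fourier multiplier with symbol `ξⱼ ξₖ / |ξ|²`. -/
def riesz (j k : Fin 3) : L2 →L[ℂ] L2 :=
  ((Lp.fourierTransformₗᵢ Space ℂ).symm.toContinuousLinearEquiv : L2 →L[ℂ] L2) ∘L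
    ((ContinuousLinearMap.mul ℂ ℂ).holderL (volume : Measure Space) ∞ 2 2
      (memLp_rieszSymbol j k).toLp) ∘L
    ((Lp.fourierTransformₗᵢ Space ℂ).toContinuousLinearEquiv : L2 →L[ℂ] L2)

/-- The matrix of bounded operators
```
  f Δ⁻¹∂xy          f - 1 + (2 - f) Δ⁻¹∂x²    0
  -f + f Δ⁻¹∂y²     (2 - f) Δ⁻¹∂xy            0
  f Δ⁻¹∂yz          (2 - f) Δ⁻¹∂xz            0
```
-/
def lowerMatrix (f : ℝ) : Matrix (Fin 3) (Fin 3) (L2 →L[ℂ] L2) :=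
  let c : ℂ := (f : ℂ)
  let I : L2 →L[ℂ] L2 := ContinuousLinearMap.id ℂ L2
  !![c • riesz 0 1, (c - 1) • I + (2 - c) • riesz 0 0, 0;
     -(c • I) + c • riesz 1 1, (2 - c) • riesz 0 1, 0;
     c • riesz 1 2, (2 - c) • riesz 0 2, 0]

/-- A matrix of bounded operators on `L²(ℝ³)`, acting on `[L²(ℝ³)]³`. -/
def matrixOp (M : Matrix (Fin 3) (Fin 3) (L2 →L[ℂ] L2)) : L2Vec →ₗ[ℂ] L2Vec where
  toFun := fun u => WithLp.toLp 2 (fun i => ∑ j, M i j (u j))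
  map_add' := fun u v => by
    ext1 i
    simp [Finset.sum_add_distrib]
  map_smul' := fun c u => by
    ext1 i
    simp [Finset.smul_sum]

/-- The linearized operator `(ν Δ - y ∂ₓ) I₃ + lowerMatrix f` in `[L²(ℝ³)]³`. -/
def linOp (ν f : ℝ) : L2Vec →ₗ.[ℂ] L2Vec :=
  matrixOp (lowerMatrix f) +ᵥ diagOp (scalarOp ν)

theorem mem_linOp_domain {ν : ℝ} (hν : ν ≠ 0) (f : ℝ) (u : L2Vec) :
    u ∈ (linOp ν f).domain ↔
      ∀ i, (∃ v : L2, toDistr v = (ν : ℂ) • laplacianDistr (u i)) ∧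
        ∃ w : L2, toDistr w = shearDistr (u i) := by
  have hc : (ν : ℂ) ≠ 0 := by exact_mod_cast hν
  refine forall_congr' fun i => and_congr ⟨?_, ?_⟩ Iff.rfl
  · rintro ⟨v, hv⟩
    exact ⟨(ν : ℂ) • v, by rw [map_smul, hv]⟩
  · rintro ⟨v, hv⟩
    exact ⟨(ν : ℂ)⁻¹ • v, by rw [map_smul, hv, inv_smul_smul₀ hc]⟩

/-! ### Strongly continuous semigroups -/

/-- A `C₀`-semigroup of bounded linear operators on a complex normed space. -/
structure C0Semigroup (X : Type*) [NormedAddCommGroup X] [NormedSpace ℂ X] where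
  /-- The operator at time `t ≥ 0`. -/
  op : ℝ≥0 → X →L[ℂ] X
  op_zero : op 0 = ContinuousLinearMap.id ℂ X
  op_add : ∀ s t, op (s + t) = op s ∘L op t
  tendsto_op : ∀ x, Tendsto (fun t => op t x) (𝓝[>] 0) (𝓝 x)

/-- `A` is the infinitesimal generator of the semigroup `S`: the domain of `A` consists of exactly
those `x` for which `(S t x - x) / t` converges as `t ↓ 0`, and the limit is `A x`. -/
def C0Semigroup.IsGeneratedBy {X : Type*} [NormedAddCommGroup X] [NormedSpace ℂ X]
    (S : C0Semigroup X) (A : X →ₗ.[ℂ] X) : Prop :=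
  ∀ x y : X, (x, y) ∈ A.graph ↔
    Tendsto (fun t : ℝ≥0 => ((t : ℝ)⁻¹ : ℂ) • (S.op t x - x)) (𝓝[>] 0) (𝓝 y)

end CouetteCoriolis

end

/-! The matrix part is bounded, so everything rests on `ν Δ - y ∂ₓ` with its exact domain. Under the
Fourier transform normalized with `e^{-2πi x·ξ}` this operator becomes `-c|ξ|² + ξ₀ ∂_{ξ₁}` with `c
= 4π²ν`. This is damped transport along the linear shear `ξ ↦ ξ + t ξ₀ e₁`, solved explicitly by `u
↦ e^{-phase c t ξ} u(shear t ξ)`. Since the shear preserves volume and the phase is nonnegative for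
`t ≥ 0`, these operators form a contraction semigroup (`fourierSemigroup`).

Its generator is the weak one, defined by pairing with test functions (`tendsto_iff_isWeakGen`). The
transposed flow maps test functions to test functions and commutes with the transposed generator, so
a weak identity `Au = g` integrates to `S(t)u - u = ∫₀ᵗ S(r)g dr`, which is then differentiated
strongly at `0`.

The weak generator only asks that the sum `ν Δu - y ∂ₓu` lie in `L²`, while the stated domain asks
it of each term. The gap is closed by an energy estimate for `m = c|ξ|²`
(`IsWeakGen.norm_symbol_cutoff_le`). The derivative of `m` along the shear is `2cξ₀ξ₁`, bounded by
`m` itself, so the transport term is of lower order than the dissipation `m²|u|²`, and `‖m u‖` is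
controlled by `‖u‖` and `‖g‖`. Hence `Δu`, and by subtraction `y ∂ₓu`, lie in `L²`
(`mem_graph_scalarOp_iff`).

The bounded matrix is added by solving a Volterra equation in an exponentially weighted sup norm
(`IsContraction.exists_isGeneratedBy_vadd`); this does not change the domain. Closedness follows
because the weak identity survives `L²` limits. -/

open MeasureTheory Filter Topology
open scoped ENNReal NNReal SchwartzMap FourierTransform LineDeriv Laplacian

noncomputable section

namespace CouetteCoriolis

/-! ### Bounded perturbations of contraction semigroups -/

namespace C0Semigroup

variable {X : Type*} [NormedAddCommGroup X] [NormedSpace ℂ X]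

/-- A semigroup of contractions. -/
def IsContraction (S : C0Semigroup X) : Prop := ∀ t x, ‖S.op t x‖ ≤ ‖x‖

theorem op_zero_apply (S : C0Semigroup X) (x : X) : S.op 0 x = x := by
  rw [S.op_zero]; rfl

theorem op_add_apply (S : C0Semigroup X) (s t : ℝ≥0) (x : X) :
    S.op (s + t) x = S.op s (S.op t x) := by
  rw [S.op_add]; rfl

theorem tendsto_op_nhds_zero (S : C0Semigroup X) (x : X) :
    Tendsto (fun t => S.op t x) (𝓝 0) (𝓝 x) := by
  have h : ContinuousWithinAt (fun t => S.op t x) (Set.Ioi 0) 0 := by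
    simpa [ContinuousWithinAt, S.op_zero_apply] using S.tendsto_op x
  have h2 := continuousWithinAt_Ioi_iff_Ici.1 h
  have h3 : (Set.Ici (0 : ℝ≥0)) = Set.univ := by ext; simp
  rw [h3, continuousWithinAt_univ] at h2
  simpa [ContinuousAt, S.op_zero_apply] using h2

/-- For `s ≤ t` the increment is `S(s)(S(t-s)x - x)`, and contractivity bounds it by the increment
at `0`. The bound depends only on the distance of the times, so continuity from the left comes
along. -/
theorem IsContraction.continuous_op {S : C0Semigroup X} (hS : S.IsContraction) (x : X) :
    Continuous (fun t => S.op t x) := by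
  have key : ∀ s t : ℝ≥0, dist (S.op s x) (S.op t x) ≤ ‖S.op (nndist s t) x - x‖ := by
    have main : ∀ s t : ℝ≥0, s ≤ t →
        dist (S.op t x) (S.op s x) ≤ ‖S.op (nndist t s) x - x‖ := by
      intro s t hst
      obtain ⟨r, rfl⟩ := exists_add_of_le hst
      have hr : nndist (s + r) s = r := by
        ext; simp [NNReal.dist_eq]
      rw [hr, dist_eq_norm, S.op_add_apply, ← map_sub]
      exact hS _ _
    intro s t
    rcases le_total s t with h | h
    · rw [dist_comm, nndist_comm]; exact main s t h
    · exact main t s h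
  refine continuous_iff_continuousAt.2 fun t => ?_
  refine tendsto_iff_dist_tendsto_zero.2 ?_
  refine squeeze_zero (fun _ => dist_nonneg) (fun s => key s t) ?_
  have h1 : Tendsto (fun s => nndist s t) (𝓝 t) (𝓝 0) := by
    have : Continuous (fun s => nndist s t) := by fun_prop
    simpa using this.tendsto t
  have := ((S.tendsto_op_nhds_zero x).comp h1).sub_const x
  simpa using this.norm

theorem IsContraction.continuous_op_comp {S : C0Semigroup X} (hS : S.IsContraction)
    {Y : Type*} [TopologicalSpace Y] {a : Y → ℝ≥0} {b : Y → X} (ha : Continuous a)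
    (hb : Continuous b) : Continuous (fun y => S.op (a y) (b y)) := by
  refine continuous_iff_continuousAt.2 fun y => ?_
  refine tendsto_iff_dist_tendsto_zero.2 ?_
  have h1 : Tendsto (fun z => ‖b z - b y‖ + dist (S.op (a z) (b y)) (S.op (a y) (b y)))
      (𝓝 y) (𝓝 0) := by
    have c : Continuous
        (fun z => ‖b z - b y‖ + dist (S.op (a z) (b y)) (S.op (a y) (b y))) :=
      (hb.sub continuous_const).norm.add
        (((hS.continuous_op (b y)).comp ha).dist continuous_const)
    simpa using c.tendsto y
  refine squeeze_zero (fun _ => dist_nonneg) (fun z => ?_) h1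
  refine (dist_triangle _ (S.op (a z) (b y)) _).trans ?_
  gcongr
  rw [dist_eq_norm, ← map_sub]
  exact hS _ _

theorem mem_graph_vadd (B : X →L[ℂ] X) {A : X →ₗ.[ℂ] X} (x y : X) :
    (x, y) ∈ ((B : X →ₗ[ℂ] X) +ᵥ A).graph ↔ (x, y - B x) ∈ A.graph := by
  simp only [LinearPMap.mem_graph_iff]
  constructor
  · rintro ⟨z, rfl, hz⟩
    refine ⟨z, rfl, ?_⟩
    rw [← hz]
    change A z = (B z + A z) - B z
    abel
  · rintro ⟨z, rfl, hz⟩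
    refine ⟨z, rfl, ?_⟩
    change B z + A z = y
    rw [hz]; abel

/-! ### The Volterra equation for the perturbed semigroup -/

section Perturbation

open BoundedContinuousFunction

variable {S : C0Semigroup X}

/-- The integrand of the Volterra operator. -/
def volterraIntegrand (S : C0Semigroup X) (B : X →L[ℂ] X) (l : ℝ) (w : ℝ≥0 → X)
    (t : ℝ≥0) (r : ℝ) : X :=
  Real.exp (-l * r) • S.op r.toNNReal (B (w (t - r.toNNReal)))

theorem volterraIntegrand_zero (S : C0Semigroup X) (B : X →L[ℂ] X) (w : ℝ≥0 → X) (t : ℝ≥0)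
    (r : ℝ) : volterraIntegrand S B 0 w t r = S.op r.toNNReal (B (w (t - r.toNNReal))) := by
  simp [volterraIntegrand]

/-- The truncations `toNNReal` and `t - r` make the integrand continuous on all of `ℝ≥0 × ℝ`,
although only `0 ≤ r ≤ t` is ever integrated. -/
theorem continuous_volterraIntegrand (hS : S.IsContraction) (B : X →L[ℂ] X) (l : ℝ)
    {w : ℝ≥0 → X} (hw : Continuous w) :
    Continuous (Function.uncurry (volterraIntegrand S B l w)) := by
  unfold volterraIntegrand Function.uncurry
  refine (show Continuous fun x : ℝ≥0 × ℝ => Real.exp (-l * x.2) by fun_prop).smul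
    (hS.continuous_op_comp (by fun_prop) ?_)
  have : Continuous fun x : ℝ≥0 × ℝ => x.1 - x.2.toNNReal := by fun_prop
  exact B.continuous.comp (hw.comp this)

theorem continuous_volterraIntegrand_right (hS : S.IsContraction) (B : X →L[ℂ] X) (l : ℝ)
    {w : ℝ≥0 → X} (hw : Continuous w) (t : ℝ≥0) :
    Continuous (volterraIntegrand S B l w t) :=
  (continuous_volterraIntegrand hS B l hw).comp (Continuous.prodMk_right t)

/-- The exponential weight has `∫₀ᵗ e^{-lr} dr ≤ 1/l`, uniformly in `t`. -/
theorem norm_volterra_le (hS : S.IsContraction) (B : X →L[ℂ] X) {l : ℝ} (hl : 0 < l)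
    (w : ℝ≥0 →ᵇ X) (t : ℝ≥0) :
    ‖∫ r in (0 : ℝ)..t, volterraIntegrand S B l w t r‖ ≤ (‖B‖ / l) * ‖w‖ := by
  have h1 : ∀ r : ℝ, ‖volterraIntegrand S B l w t r‖ ≤ Real.exp (-l * r) * (‖B‖ * ‖w‖) := by
    intro r
    rw [volterraIntegrand, norm_smul, Real.norm_eq_abs, abs_of_pos (Real.exp_pos _)]
    gcongr
    exact (hS _ _).trans (B.le_opNorm_of_le (w.norm_coe_le_norm _))
  have h2 : ∫ r in (0 : ℝ)..t, Real.exp (-l * r) * (‖B‖ * ‖w‖)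
      = (1 - Real.exp (-l * t)) / l * (‖B‖ * ‖w‖) := by
    rw [intervalIntegral.integral_mul_const]
    congr 1
    rw [intervalIntegral.integral_comp_mul_left (fun r => Real.exp r) (by linarith), integral_exp]
    simp only [mul_zero, Real.exp_zero, smul_eq_mul]
    field_simp
    ring
  refine (intervalIntegral.norm_integral_le_of_norm_le t.coe_nonneg
    (ae_of_all _ fun r _ => h1 r) ?_).trans ?_
  · exact Continuous.intervalIntegrable (by fun_prop) _ _
  · have e1 := Real.exp_pos (-l * t)
    rw [h2, div_mul_eq_mul_div, div_mul_eq_mul_div]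
    refine div_le_div_of_nonneg_right ?_ hl.le
    nlinarith [mul_nonneg (norm_nonneg B) (norm_nonneg w)]

/-- The Volterra operator `w ↦ (t ↦ ∫₀ᵗ e^{-lr} S(r) B w(t - r) dr)`. -/
def volterra (hS : S.IsContraction) (B : X →L[ℂ] X) {l : ℝ} (hl : 0 < l) :
    (ℝ≥0 →ᵇ X) →L[ℂ] (ℝ≥0 →ᵇ X) :=
  LinearMap.mkContinuous
    { toFun := fun w => BoundedContinuousFunction.ofNormedAddCommGroup
        (fun t => ∫ r in (0 : ℝ)..t, volterraIntegrand S B l w t r)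
        (intervalIntegral.continuous_parametric_intervalIntegral_of_continuous
          (continuous_volterraIntegrand hS B l w.continuous) NNReal.continuous_coe)
        (‖B‖ / l * ‖w‖) (norm_volterra_le hS B hl w)
      map_add' := fun v w => by
        ext t
        have hv := continuous_volterraIntegrand_right hS B l v.continuous t
        have hw := continuous_volterraIntegrand_right hS B l w.continuous t
        change ∫ r in (0 : ℝ)..t, volterraIntegrand S B l (v + w) t r =
          (∫ r in (0 : ℝ)..t, volterraIntegrand S B l v t r) +
            ∫ r in (0 : ℝ)..t, volterraIntegrand S B l w t r
        rw [← intervalIntegral.integral_add (hv.intervalIntegrable _ _)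
          (hw.intervalIntegrable _ _)]
        simp [volterraIntegrand]
      map_smul' := fun c w => by
        ext t
        change ∫ r in (0 : ℝ)..t, volterraIntegrand S B l (c • w) t r =
          c • ∫ r in (0 : ℝ)..t, volterraIntegrand S B l w t r
        rw [← intervalIntegral.integral_smul]
        simp [volterraIntegrand, smul_comm c] }
    (‖B‖ / l) (fun w => (BoundedContinuousFunction.norm_le (by positivity)).2
      (norm_volterra_le hS B hl w))

theorem volterra_apply (hS : S.IsContraction) (B : X →L[ℂ] X) {l : ℝ} (hl : 0 < l)
    (w : ℝ≥0 →ᵇ X) (t : ℝ≥0) :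
    volterra hS B hl w t = ∫ r in (0 : ℝ)..t, volterraIntegrand S B l w t r := rfl

theorem norm_volterra_lt_one (hS : S.IsContraction) (B : X →L[ℂ] X) {l : ℝ} (hl : 0 < l)
    (h : ‖B‖ < l) : ‖volterra hS B hl‖ < 1 :=
  (LinearMap.mkContinuous_norm_le _ (by positivity) _).trans_lt ((div_lt_one hl).2 h)

/-- The damped orbit map `x ↦ (t ↦ e^{-lt} S(t) x)`. -/
def orbit (hS : S.IsContraction) {l : ℝ} (hl : 0 < l) : X →L[ℂ] (ℝ≥0 →ᵇ X) :=
  have hb : ∀ x (t : ℝ≥0), ‖Real.exp (-l * t) • S.op t x‖ ≤ 1 * ‖x‖ := fun x t => by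
    rw [norm_smul, Real.norm_eq_abs, abs_of_pos (Real.exp_pos _)]
    refine mul_le_mul (Real.exp_le_one_iff.2 ?_) (hS t x) (norm_nonneg _) zero_le_one
    have := mul_nonneg hl.le t.coe_nonneg
    simpa using this
  LinearMap.mkContinuous
    { toFun := fun x => BoundedContinuousFunction.ofNormedAddCommGroup
        (fun t : ℝ≥0 => Real.exp (-l * t) • S.op t x)
        ((show Continuous fun t : ℝ≥0 => Real.exp (-l * t) by fun_prop).smul
          (hS.continuous_op x)) (1 * ‖x‖) (hb x)
      map_add' := fun x y => by ext t; simp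
      map_smul' := fun c x => by ext t; simp [smul_comm c] }
    1 (fun x => (BoundedContinuousFunction.norm_le (by positivity)).2 (hb x))

variable [CompleteSpace X]

/-- Cut the integral at `r = s`. The first piece sees only the translate of `w`; in the second, `r =
s + r'` lets `e^{-ls} S(s)` be pulled out. This is what yields the semigroup law. -/
theorem volterra_shift (hS : S.IsContraction) (B : X →L[ℂ] X) {l : ℝ} (hl : 0 < l)
    (w : ℝ≥0 →ᵇ X) (s t : ℝ≥0) :
    ∫ r in (0 : ℝ)..(s + t : ℝ≥0), volterraIntegrand S B l w (s + t) r =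
      (∫ r in (0 : ℝ)..s, volterraIntegrand S B l (fun a => w (a + t)) s r) +
        Real.exp (-l * s) • S.op s (volterra hS B hl w t) := by
  have hc := continuous_volterraIntegrand_right hS B l w.continuous (s + t)
  rw [← intervalIntegral.integral_add_adjacent_intervals (b := (s : ℝ))
    (hc.intervalIntegrable _ _) (hc.intervalIntegrable _ _)]
  congr 1
  · refine intervalIntegral.integral_congr fun r hr => ?_
    rw [Set.uIcc_of_le s.coe_nonneg] at hr
    have : s + t - r.toNNReal = s - r.toNNReal + t := by
      rw [tsub_add_eq_add_tsub]
      exact Real.toNNReal_le_iff_le_coe.2 hr.2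
    simp only [volterraIntegrand, this]
  · have hct := continuous_volterraIntegrand_right hS B l w.continuous t
    rw [volterra_apply hS B, ← ContinuousLinearMap.intervalIntegral_comp_comm _
      (hct.intervalIntegrable _ _), ← intervalIntegral.integral_smul]
    have := intervalIntegral.integral_comp_add_left (a := (0 : ℝ)) (b := (t : ℝ))
      (volterraIntegrand S B l w (s + t)) (s : ℝ)
    rw [add_zero, ← NNReal.coe_add] at this
    rw [← this]
    refine intervalIntegral.integral_congr fun r hr => ?_
    rw [Set.uIcc_of_le t.coe_nonneg] at hr
    have e : ((s : ℝ) + r).toNNReal = s + r.toNNReal := by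
      rw [Real.toNNReal_add s.coe_nonneg hr.1, Real.toNNReal_coe]
    simp only [volterraIntegrand, e, add_tsub_add_eq_tsub_left, S.op_add_apply]
    rw [ContinuousLinearMap.map_smul_of_tower, smul_smul, ← Real.exp_add]
    congr 2
    ring

/-- The integrand depends on the endpoint `t` as well, so joint continuity at `(0, 0)` is used in
place of the fundamental theorem of calculus. -/
theorem tendsto_volterra_average (hS : S.IsContraction) (B : X →L[ℂ] X) (l : ℝ)
    {w : ℝ≥0 → X} (hw : Continuous w) :
    Tendsto (fun t : ℝ≥0 => ((t : ℝ)⁻¹ : ℂ) • ∫ r in (0 : ℝ)..t, volterraIntegrand S B l w t r)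
      (𝓝[>] 0) (𝓝 (B (w 0))) := by
  have hc := (continuous_volterraIntegrand hS B l hw).tendsto (0, 0)
  have h0 : Function.uncurry (volterraIntegrand S B l w) (0, 0) = B (w 0) := by
    simp [volterraIntegrand, S.op_zero_apply]
  rw [h0, Metric.tendsto_nhds_nhds] at hc
  rw [Metric.tendsto_nhdsWithin_nhds]
  intro ε hε
  obtain ⟨δ, hδ, h⟩ := hc (ε / 2) (half_pos hε)
  refine ⟨δ, hδ, fun {t} ht htδ => ?_⟩
  have ht0 : (0 : ℝ) < t := by simpa using ht
  have hct := continuous_volterraIntegrand_right hS B l hw t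
  have hb : ‖∫ r in (0 : ℝ)..t, (volterraIntegrand S B l w t r - B (w 0))‖ ≤
      (ε / 2) * |(t : ℝ) - 0| := by
    refine intervalIntegral.norm_integral_le_of_norm_le_const fun r hr => ?_
    rw [Set.uIoc_of_le ht0.le] at hr
    have hd : dist ((t, r) : ℝ≥0 × ℝ) (0, 0) < δ := by
      rw [Prod.dist_eq]
      refine max_lt htδ ?_
      rw [NNReal.dist_eq] at htδ
      simp only [NNReal.coe_zero, sub_zero, abs_of_pos ht0] at htδ
      rw [Real.dist_eq, sub_zero, abs_of_pos hr.1]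
      exact hr.2.trans_lt htδ
    have := h hd
    rw [dist_eq_norm] at this
    exact this.le
  rw [intervalIntegral.integral_sub (hct.intervalIntegrable _ _) (by simp)] at hb
  rw [intervalIntegral.integral_const, sub_zero, abs_of_pos ht0] at hb
  have e : ((t : ℝ)⁻¹ : ℂ) • (∫ r in (0 : ℝ)..t, volterraIntegrand S B l w t r) - B (w 0) =
      ((t : ℝ)⁻¹ : ℂ) •
        ((∫ r in (0 : ℝ)..t, volterraIntegrand S B l w t r) - (t : ℝ) • B (w 0)) := by
    rw [smul_sub, ← Complex.coe_smul (t : ℝ), smul_smul, inv_mul_cancel₀, one_smul]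
    exact_mod_cast ht0.ne'
  rw [dist_eq_norm, e, norm_smul, norm_inv, Complex.norm_real, Real.norm_eq_abs, abs_of_pos ht0]
  calc (t : ℝ)⁻¹ * _ ≤ (t : ℝ)⁻¹ * (ε / 2 * t) := by gcongr
    _ = ε / 2 := by field_simp
    _ < ε := half_lt_self hε

/-- A bounded perturbation of the generator of a contraction semigroup is a generator. -/
theorem IsContraction.exists_isGeneratedBy_vadd (hS : S.IsContraction) (B : X →L[ℂ] X)
    {A : X →ₗ.[ℂ] X} (hA : S.IsGeneratedBy A) :
    ∃ V : C0Semigroup X, V.IsGeneratedBy ((B : X →ₗ[ℂ] X) +ᵥ A) := by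
  -- Any `l > ‖B‖` makes the Volterra operator a strict contraction, so that `1 - volterra` is
  -- invertible.
  set l : ℝ := ‖B‖ + 1
  have hl : 0 < l := by positivity
  obtain ⟨U, hU⟩ := isUnit_one_sub_of_norm_lt_one
    (norm_volterra_lt_one hS B hl (lt_add_one _))
  set R : X →L[ℂ] (ℝ≥0 →ᵇ X) := (↑U⁻¹ : (ℝ≥0 →ᵇ X) →L[ℂ] (ℝ≥0 →ᵇ X)) ∘L orbit hS hl with hR
  have hfix : ∀ x, R x = orbit hS hl x + volterra hS B hl (R x) := by
    intro x
    have h1 : (U : (ℝ≥0 →ᵇ X) →L[ℂ] (ℝ≥0 →ᵇ X)) (R x) = orbit hS hl x := by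
      change ((U : (ℝ≥0 →ᵇ X) →L[ℂ] (ℝ≥0 →ᵇ X)) * (↑U⁻¹ : (ℝ≥0 →ᵇ X) →L[ℂ] (ℝ≥0 →ᵇ X)))
        (orbit hS hl x) = _
      rw [Units.mul_inv]; rfl
    rw [hU] at h1
    exact sub_eq_iff_eq_add.1 h1
  have huniq : ∀ x w, w = orbit hS hl x + volterra hS B hl w → w = R x := by
    intro x w hw
    have h1 : (U : (ℝ≥0 →ᵇ X) →L[ℂ] (ℝ≥0 →ᵇ X)) w = orbit hS hl x := by
      rw [hU]; exact sub_eq_iff_eq_add.2 hw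
    change w = (↑U⁻¹ : (ℝ≥0 →ᵇ X) →L[ℂ] (ℝ≥0 →ᵇ X)) (orbit hS hl x)
    rw [← h1]
    change _ = ((↑U⁻¹ : (ℝ≥0 →ᵇ X) →L[ℂ] (ℝ≥0 →ᵇ X)) *
      (U : (ℝ≥0 →ᵇ X) →L[ℂ] (ℝ≥0 →ᵇ X))) w
    rw [Units.inv_mul]; rfl
  have hfix' : ∀ x (t : ℝ≥0), R x t = Real.exp (-l * t) • S.op t x +
      ∫ r in (0 : ℝ)..t, volterraIntegrand S B l (R x) t r := fun x t =>
    DFunLike.congr_fun (hfix x) t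
  have hzero : ∀ x, R x 0 = x := fun x => by
    rw [hfix']; simp [S.op_zero_apply]
  -- The translate of the solution solves the equation with initial value `R x t`; uniqueness
  -- identifies the two.
  have hshift : ∀ x s t, R x (s + t) = R (R x t) s := by
    intro x s t
    set w : ℝ≥0 →ᵇ X := (R x).compContinuous ⟨fun a => a + t, by fun_prop⟩ with hw
    have : w = R (R x t) := by
      refine huniq _ _ ?_
      ext a
      change R x (a + t) = Real.exp (-l * a) • S.op a (R x t) +
        ∫ r in (0 : ℝ)..a, volterraIntegrand S B l (fun a => R x (a + t)) a r
      have h1 : R x t = Real.exp (-l * t) • S.op t x + volterra hS B hl (R x) t := hfix' x t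
      rw [hfix', volterra_shift hS B hl, h1, map_add, smul_add, S.op_add_apply,
        ContinuousLinearMap.map_smul_of_tower, smul_smul, ← Real.exp_add, NNReal.coe_add, mul_add]
      abel
    rw [← this]; rfl
  have hcont : ∀ x, Continuous fun t : ℝ≥0 => Real.exp (l * t) • R x t := fun x =>
    (show Continuous fun t : ℝ≥0 => Real.exp (l * t) by fun_prop).smul (R x).continuous
  -- `R` is the damped orbit; the factor `e^{lt}` removes the damping.
  refine ⟨⟨fun t => Real.exp (l * t) • ((evalCLM ℂ t) ∘L R), ?_, ?_, ?_⟩, ?_⟩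
  · ext x
    change Real.exp (l * (0 : ℝ≥0)) • R x 0 = x
    simp [hzero]
  · intro s t
    ext x
    change Real.exp (l * (s + t : ℝ≥0)) • R x (s + t) =
      Real.exp (l * s) • R (Real.exp (l * t) • R x t) s
    rw [hshift, ContinuousLinearMap.map_smul_of_tower, BoundedContinuousFunction.coe_smul,
      smul_smul, ← Real.exp_add, NNReal.coe_add, mul_add]
  · intro x
    have := (hcont x).tendsto 0
    simp only [NNReal.coe_zero, mul_zero, Real.exp_zero, one_smul, hzero] at this
    exact this.mono_left nhdsWithin_le_nhds
  · intro x y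
    rw [mem_graph_vadd, hA]
    -- This term converges for every `x`, so the perturbed and unperturbed difference quotients
    -- converge for the same `x`: the domains agree exactly.
    have hE : Tendsto (fun t : ℝ≥0 => Real.exp (l * t) •
        (((t : ℝ)⁻¹ : ℂ) • ∫ r in (0 : ℝ)..t, volterraIntegrand S B l (R x) t r))
        (𝓝[>] 0) (𝓝 (B x)) := by
      have h1 : Tendsto (fun t : ℝ≥0 => Real.exp (l * t)) (𝓝[>] 0) (𝓝 1) := by
        have c : Continuous fun t : ℝ≥0 => Real.exp (l * t) := by fun_prop
        have := c.tendsto 0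
        simp only [NNReal.coe_zero, mul_zero, Real.exp_zero] at this
        exact this.mono_left nhdsWithin_le_nhds
      have := h1.smul (tendsto_volterra_average hS B l (R x).continuous)
      rwa [hzero, one_smul] at this
    have hdiff : ∀ t : ℝ≥0, ((t : ℝ)⁻¹ : ℂ) • (Real.exp (l * t) • R x t - x) =
        ((t : ℝ)⁻¹ : ℂ) • (S.op t x - x) + Real.exp (l * t) •
        (((t : ℝ)⁻¹ : ℂ) • ∫ r in (0 : ℝ)..t, volterraIntegrand S B l (R x) t r) := by
      intro t
      rw [hfix' x t, smul_add, smul_smul, ← Real.exp_add, smul_comm (Real.exp _), ← smul_add]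
      have : l * (t : ℝ) + -l * t = 0 := by ring
      rw [this, Real.exp_zero, one_smul]
      congr 1
      abel
    change _ ↔ Tendsto (fun t : ℝ≥0 => ((t : ℝ)⁻¹ : ℂ) • (Real.exp (l * t) • R x t - x)) _ _
    simp_rw [hdiff]
    constructor
    · intro h
      simpa using h.add hE
    · intro h
      simpa using h.sub hE

end Perturbation

end C0Semigroup

/-! ### The semigroup of the scalar operator on the Fourier side -/

/-- The shear flow on the frequency side. -/
def shear (t : ℝ) : Space →L[ℝ] Space :=
  ContinuousLinearMap.id ℝ Space +
    (t • EuclideanSpace.proj (0 : Fin 3) : Space →L[ℝ] ℝ).smulRight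
      (EuclideanSpace.single (1 : Fin 3) (1 : ℝ))

theorem shear_apply (t : ℝ) (ξ : Space) :
    shear t ξ = ξ + (t * ξ 0) • EuclideanSpace.single (1 : Fin 3) (1 : ℝ) := rfl

@[simp] theorem shear_apply_zero (t : ℝ) (ξ : Space) : shear t ξ 0 = ξ 0 := by
  simp [shear_apply]

@[simp] theorem shear_apply_one (t : ℝ) (ξ : Space) : shear t ξ 1 = ξ 1 + t * ξ 0 := by
  simp [shear_apply]

@[simp] theorem shear_apply_two (t : ℝ) (ξ : Space) : shear t ξ 2 = ξ 2 := by
  simp [shear_apply]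

theorem ext_space {ξ η : Space} (h0 : ξ 0 = η 0) (h1 : ξ 1 = η 1) (h2 : ξ 2 = η 2) : ξ = η := by
  ext i; fin_cases i <;> assumption

theorem shear_shear (s t : ℝ) (ξ : Space) : shear s (shear t ξ) = shear (s + t) ξ :=
  ext_space (by simp) (by simp; ring) (by simp)

@[simp] theorem shear_zero (ξ : Space) : shear 0 ξ = ξ := by simp [shear_apply]

theorem shear_neg_shear (t : ℝ) (ξ : Space) : shear (-t) (shear t ξ) = ξ := by
  simp [shear_shear]

theorem shear_shear_neg (t : ℝ) (ξ : Space) : shear t (shear (-t) ξ) = ξ := by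
  simp [shear_shear]

theorem continuous_shear_uncurry : Continuous fun p : ℝ × Space => shear p.1 p.2 := by
  simp only [shear_apply]
  fun_prop

theorem measurePreserving_shear (t : ℝ) :
    MeasurePreserving (shear t) (volume : Measure Space) volume := by
  have hdet : LinearMap.det (shear t : Space →ₗ[ℝ] Space) = 1 := by
    have : (shear t : Space →ₗ[ℝ] Space) = LinearMap.transvection
        ((t • EuclideanSpace.proj (0 : Fin 3) : Space →L[ℝ] ℝ) : Space →ₗ[ℝ] ℝ)
        (EuclideanSpace.single (1 : Fin 3) (1 : ℝ)) := by
      ext ξ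
      rfl
    rw [this, LinearMap.transvection.det]
    simp
  refine ⟨(shear t).continuous.measurable, ?_⟩
  have h := Measure.map_linearMap_addHaar_eq_smul_addHaar (volume : Measure Space)
    (f := (shear t : Space →ₗ[ℝ] Space)) (by rw [hdet]; exact one_ne_zero)
  rw [hdet] at h
  simpa using h

/-- The shear flow as a homeomorphism. -/
def shearHomeomorph (t : ℝ) : Space ≃ₜ Space where
  toFun := shear t
  invFun := shear (-t)
  left_inv := shear_neg_shear t
  right_inv := shear_shear_neg t
  continuous_toFun := (shear t).continuous
  continuous_invFun := (shear (-t)).continuous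

/-- The symbol `c |ξ|²`. -/
def diffSymbol (c : ℝ) (ξ : Space) : ℝ := c * (ξ 0 ^ 2 + ξ 1 ^ 2 + ξ 2 ^ 2)

theorem norm_sq_space (ξ : Space) : ‖ξ‖ ^ 2 = ξ 0 ^ 2 + ξ 1 ^ 2 + ξ 2 ^ 2 := by
  simp [EuclideanSpace.real_norm_sq_eq, Fin.sum_univ_three]

/-- The integral of `diffSymbol c` along the shear flow during a time `t`. -/
def phase (c t : ℝ) (ξ : Space) : ℝ :=
  c * (t * (ξ 0 ^ 2 + ξ 1 ^ 2 + ξ 2 ^ 2) + t ^ 2 * (ξ 0 * ξ 1) + t ^ 3 / 3 * ξ 0 ^ 2)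

/-- The cocycle identity for an integral along a flow; it makes the damped shears compose as a
semigroup. -/
theorem phase_add (c s t : ℝ) (ξ : Space) :
    phase c (s + t) ξ = phase c s ξ + phase c t (shear s ξ) := by
  simp only [phase, shear_apply_zero, shear_apply_one, shear_apply_two]
  ring

theorem phase_nonneg {c t : ℝ} (hc : 0 ≤ c) (ht : 0 ≤ t) (ξ : Space) : 0 ≤ phase c t ξ := by
  -- Completing the square in `ξ₁` costs `t²ξ₀²/4`, which leaves `1/3 - 1/4 = 1/12`.
  have : phase c t ξ = c * (t * ((ξ 1 + t * ξ 0 / 2) ^ 2 + ξ 0 ^ 2 + ξ 2 ^ 2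
      + t ^ 2 * ξ 0 ^ 2 / 12)) := by
    simp only [phase]; ring
  rw [this]; positivity

theorem continuous_phase_uncurry (c : ℝ) : Continuous fun p : ℝ × Space => phase c p.1 p.2 := by
  unfold phase; fun_prop

/-- The damping factor `e^{-phase c t ξ}`. -/
def damping (c t : ℝ) (ξ : Space) : ℂ := (Real.exp (-phase c t ξ) : ℂ)

theorem continuous_damping_uncurry (c : ℝ) :
    Continuous fun p : ℝ × Space => damping c p.1 p.2 :=
  Complex.continuous_ofReal.comp (Real.continuous_exp.comp (continuous_phase_uncurry c).neg)

theorem continuous_damping (c t : ℝ) : Continuous (damping c t) :=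
  (continuous_damping_uncurry c).comp (Continuous.prodMk_right t)

theorem norm_damping (c t : ℝ) (ξ : Space) : ‖damping c t ξ‖ = Real.exp (-phase c t ξ) := by
  rw [damping, Complex.norm_real, Real.norm_eq_abs, abs_of_pos (Real.exp_pos _)]

theorem norm_damping_le {c t : ℝ} (hc : 0 ≤ c) (ht : 0 ≤ t) (ξ : Space) :
    ‖damping c t ξ‖ ≤ 1 := by
  rw [norm_damping, Real.exp_le_one_iff]
  linarith [phase_nonneg hc ht ξ]

theorem damping_add (c s t : ℝ) (ξ : Space) :
    damping c (s + t) ξ = damping c s ξ * damping c t (shear s ξ) := by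
  simp only [damping, phase_add, neg_add, Real.exp_add]
  push_cast; rfl

theorem memLp_damping {c t : ℝ} (hc : 0 ≤ c) (ht : 0 ≤ t) :
    MemLp (damping c t) ∞ (volume : Measure Space) :=
  memLp_top_of_bound (continuous_damping c t).aestronglyMeasurable 1
    (ae_of_all _ (norm_damping_le hc ht))

/-- Multiplication by an essentially bounded function. -/
def mulOp {m : Space → ℂ} (hm : MemLp m ∞ (volume : Measure Space)) : L2 →L[ℂ] L2 :=
  (ContinuousLinearMap.mul ℂ ℂ).holderL (volume : Measure Space) ∞ 2 2 hm.toLp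

theorem mulOp_ae {m : Space → ℂ} (hm : MemLp m ∞ (volume : Measure Space)) (u : L2) :
    mulOp hm u =ᵐ[volume] fun ξ => m ξ * u ξ := by
  have h := (ContinuousLinearMap.mul ℂ ℂ).coeFn_holder (r := 2) hm.toLp u
  filter_upwards [h, hm.coeFn_toLp] with ξ h1 h2
  change ((ContinuousLinearMap.mul ℂ ℂ).holder 2 hm.toLp u) ξ = _
  rw [h1, h2]; rfl

/-- The pairing `u ↦ ∫ u φ` with a square integrable function. -/
def pairing {φ : Space → ℂ} (hφ : MemLp φ 2 (volume : Measure Space)) : L2 →L[ℂ] ℂ :=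
  (ContinuousLinearMap.mul ℂ ℂ).lpPairing (volume : Measure Space) 2 2 hφ.toLp

theorem pairing_apply {φ : Space → ℂ} (hφ : MemLp φ 2 (volume : Measure Space)) (u : L2) :
    pairing hφ u = ∫ ξ, φ ξ * u ξ := by
  rw [pairing, ContinuousLinearMap.lpPairing_eq_integral]
  refine integral_congr_ae ?_
  filter_upwards [hφ.coeFn_toLp] with ξ h
  rw [h]; rfl

/-- The shear flow acting on `L²`. -/
def shearOp (t : ℝ) : L2 →L[ℂ] L2 :=
  (Lp.compMeasurePreservingₗᵢ ℂ (shear t) (measurePreserving_shear t)).toContinuousLinearMap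

theorem shearOp_ae (t : ℝ) (u : L2) : shearOp t u =ᵐ[volume] fun ξ => u (shear t ξ) :=
  Lp.coeFn_compMeasurePreserving u (measurePreserving_shear t)

theorem continuous_shearOp (u : L2) : Continuous fun t => shearOp t u := by
  change Continuous fun t => Lp.compMeasurePreserving (shear t) (measurePreserving_shear t) u
  let F : ℝ → C(Space, Space) := fun t => ⟨shear t, (shear t).continuous⟩
  have hF : Continuous F := ContinuousMap.continuous_of_continuous_uncurry _
    continuous_shear_uncurry
  exact (continuous_const (y := u)).compMeasurePreservingLp hF
    (fun t => measurePreserving_shear t) (by norm_num)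

/-- The solution operator at time `t`. -/
def evolution {c : ℝ} (hc : 0 ≤ c) (t : ℝ≥0) : L2 →L[ℂ] L2 :=
  mulOp (memLp_damping hc t.coe_nonneg) ∘L shearOp t

theorem evolution_ae {c : ℝ} (hc : 0 ≤ c) (t : ℝ≥0) (u : L2) :
    evolution hc t u =ᵐ[volume] fun ξ => damping c t ξ * u (shear t ξ) := by
  filter_upwards [mulOp_ae (memLp_damping hc t.coe_nonneg) (shearOp t u), shearOp_ae t u]
    with ξ h1 h2
  change mulOp _ (shearOp t u) ξ = _
  rw [h1, h2]

theorem norm_mulOp_le {m : Space → ℂ} (hm : MemLp m ∞ (volume : Measure Space))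
    (h : ∀ ξ, ‖m ξ‖ ≤ 1) (u : L2) : ‖mulOp hm u‖ ≤ ‖u‖ := by
  refine Lp.norm_le_norm_of_ae_le ?_
  filter_upwards [mulOp_ae hm u] with ξ h1
  rw [h1, norm_mul]
  exact mul_le_of_le_one_left (norm_nonneg _) (h ξ)

theorem tendsto_mulOp_damping {c : ℝ} (hc : 0 ≤ c) (u : L2) :
    Tendsto (fun t : ℝ≥0 => mulOp (memLp_damping hc t.coe_nonneg) u) (𝓝 0) (𝓝 u) := by
  rw [Lp.tendsto_Lp_iff_tendsto_eLpNorm']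
  have hbound : ∀ (t : ℝ≥0), eLpNorm (⇑(mulOp (memLp_damping hc t.coe_nonneg) u) - ⇑u) 2 volume =
      eLpNorm (fun ξ => (damping c t ξ - 1) * u ξ) 2 volume := by
    intro t
    refine eLpNorm_congr_ae ?_
    filter_upwards [mulOp_ae (memLp_damping hc t.coe_nonneg) u] with ξ h
    rw [Pi.sub_apply, h]; ring
  simp_rw [hbound]
  have hE : ∀ t : ℝ≥0, eLpNorm (fun ξ => (damping c t ξ - 1) * u ξ) 2 volume =
      (∫⁻ ξ, ‖(damping c t ξ - 1) * u ξ‖ₑ ^ (2 : ℝ)) ^ ((1 : ℝ) / 2) := by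
    intro t
    rw [eLpNorm_eq_lintegral_rpow_enorm_toReal (by norm_num) (by norm_num)]
    simp
  simp_rw [hE]
  have hu : ∫⁻ ξ, ‖(2 : ℂ) * u ξ‖ₑ ^ (2 : ℝ) ≠ ∞ := by
    have h1 : MemLp (fun ξ => (2 : ℂ) * u ξ) 2 volume := (Lp.memLp u).const_mul 2
    have := lintegral_rpow_enorm_lt_top_of_eLpNorm_lt_top (by norm_num) (by norm_num) h1.2
    simpa using this.ne
  have hlim : Tendsto (fun t : ℝ≥0 => ∫⁻ ξ, ‖(damping c t ξ - 1) * u ξ‖ₑ ^ (2 : ℝ)) (𝓝 0)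
      (𝓝 (∫⁻ _ : Space, 0)) := by
    refine tendsto_lintegral_filter_of_dominated_convergence
      (fun ξ => ‖(2 : ℂ) * u ξ‖ₑ ^ (2 : ℝ)) ?_ ?_ hu ?_
    · refine Eventually.of_forall fun t => ?_
      exact (((continuous_damping c t).sub continuous_const).measurable.mul
        (Lp.stronglyMeasurable u).measurable).enorm.pow_const _
    · refine Eventually.of_forall fun t => ae_of_all _ fun ξ => ?_
      refine ENNReal.rpow_le_rpow (enorm_le_iff_norm_le.2 ?_) (by norm_num)
      rw [norm_mul, norm_mul]
      gcongr
      refine (norm_sub_le _ _).trans ?_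
      have := norm_damping_le hc t.coe_nonneg ξ
      rw [norm_one, Complex.norm_ofNat]
      linarith
    · refine ae_of_all _ fun ξ => ?_
      have c1 : Continuous fun t : ℝ≥0 => ‖(damping c t ξ - 1) * u ξ‖ₑ ^ (2 : ℝ) := by
        have : Continuous fun t : ℝ≥0 => damping c t ξ :=
          (continuous_damping_uncurry c).comp (by fun_prop : Continuous fun t : ℝ≥0 => ((t : ℝ), ξ))
        fun_prop
      simpa [damping, phase] using c1.tendsto 0
  simpa using hlim.ennrpow_const (1 / 2)

/-- The semigroup on the Fourier side. -/
def fourierSemigroup {c : ℝ} (hc : 0 ≤ c) : C0Semigroup L2 where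
  op := evolution hc
  op_zero := by
    ext1 u
    refine Lp.ext ?_
    filter_upwards [evolution_ae hc 0 u] with ξ h
    rw [h]
    simp [damping, phase]
  op_add s t := by
    ext1 u
    refine Lp.ext ?_
    have h3 := (measurePreserving_shear s).quasiMeasurePreserving.ae_eq_comp (evolution_ae hc t u)
    filter_upwards [evolution_ae hc (s + t) u, evolution_ae hc s (evolution hc t u), h3]
      with ξ h1 h2 h3
    simp only [Function.comp_apply] at h3
    change _ = evolution hc s (evolution hc t u) ξ
    rw [h1, h2, h3, NNReal.coe_add, damping_add, shear_shear, add_comm (t : ℝ), mul_assoc]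
  tendsto_op u := by
    refine Tendsto.mono_left ?_ nhdsWithin_le_nhds
    have h1 : Tendsto (fun t : ℝ≥0 => shearOp t u) (𝓝 0) (𝓝 u) := by
      have := ((continuous_shearOp u).comp NNReal.continuous_coe).tendsto 0
      have h0 : shearOp 0 u = u := by
        refine Lp.ext ?_
        filter_upwards [shearOp_ae 0 u] with ξ h
        rw [h, shear_zero]
      simpa [h0, Function.comp_def] using this
    have h2 := tendsto_mulOp_damping hc u
    rw [tendsto_iff_norm_sub_tendsto_zero] at h1 h2 ⊢
    refine squeeze_zero (fun _ => norm_nonneg _) (fun t => ?_) (by simpa using h1.add h2)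
    -- The first term is controlled by continuity of the shear action because the damping is a
    -- contraction; the second involves the damping of a fixed function only.
    have e : evolution hc t u - u = mulOp (memLp_damping hc t.coe_nonneg) (shearOp t u - u) +
        (mulOp (memLp_damping hc t.coe_nonneg) u - u) := by
      rw [map_sub]; simp [evolution]
    rw [e]
    exact (norm_add_le _ _).trans (add_le_add_left (norm_mulOp_le _
      (norm_damping_le hc t.coe_nonneg) _) _)

theorem isContraction_fourierSemigroup {c : ℝ} (hc : 0 ≤ c) :
    (fourierSemigroup hc).IsContraction := fun t u =>
  (norm_mulOp_le _ (norm_damping_le hc t.coe_nonneg) _).trans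
    (Lp.norm_compMeasurePreserving u (measurePreserving_shear t)).le

theorem integral_comp_shear (t : ℝ) (g : Space → ℂ) : ∫ ξ, g (shear t ξ) = ∫ ξ, g ξ :=
  (measurePreserving_shear t).integral_comp (shearHomeomorph t).measurableEmbedding g

/-- A volume-preserving change of variables moves the flow onto the other factor, which exhibits
`dualEvo` as the transpose. -/
theorem integral_mul_evolution {c : ℝ} (hc : 0 ≤ c) (t : ℝ≥0) (u : L2) (φ : Space → ℂ) :
    ∫ ξ, φ ξ * (fourierSemigroup hc).op t u ξ =
      ∫ ξ, (damping c t (shear (-t) ξ) * φ (shear (-t) ξ)) * u ξ := by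
  rw [← integral_comp_shear t fun ξ => (damping c t (shear (-t) ξ) * φ (shear (-t) ξ)) * u ξ]
  refine integral_congr_ae ?_
  filter_upwards [evolution_ae hc t u] with ξ h
  rw [shear_neg_shear]
  change φ ξ * evolution hc t u ξ = _
  rw [h]; ring

/-! ### The generator on the Fourier side, characterized by test functions -/

/-- Smooth compactly supported functions. -/
def IsTest (φ : Space → ℂ) : Prop :=
  ContDiff ℝ ((⊤ : ℕ∞) : WithTop ℕ∞) φ ∧ HasCompactSupport φ

/-- The direction of the shear on the frequency side. -/
def ey : Space := EuclideanSpace.single (1 : Fin 3) (1 : ℝ)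

@[simp] theorem ey_zero : ey 0 = 0 := by simp [ey]
@[simp] theorem ey_one : ey 1 = 1 := by simp [ey]
@[simp] theorem ey_two : ey 2 = 0 := by simp [ey]

/-- The formal transpose of the generator on the Fourier side. -/
def dualGen (c : ℝ) (φ : Space → ℂ) (ξ : Space) : ℂ :=
  -((diffSymbol c ξ : ℂ) * φ ξ) - (ξ 0 : ℂ) * fderiv ℝ φ ξ ey

/-- The transpose of the semigroup on the Fourier side. -/
def dualEvo (c t : ℝ) (φ : Space → ℂ) (ξ : Space) : ℂ :=
  damping c t (shear (-t) ξ) * φ (shear (-t) ξ)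

theorem dualEvo_zero (c : ℝ) (φ : Space → ℂ) : dualEvo c 0 φ = φ := by
  ext ξ; simp [dualEvo, damping, phase]

theorem IsTest.continuous {φ : Space → ℂ} (h : IsTest φ) : Continuous φ := h.1.continuous

theorem IsTest.differentiable {φ : Space → ℂ} (h : IsTest φ) : Differentiable ℝ φ :=
  h.1.differentiable (by simp)

theorem IsTest.memLp {φ : Space → ℂ} (h : IsTest φ) : MemLp φ 2 (volume : Measure Space) :=
  h.continuous.memLp_of_hasCompactSupport h.2

theorem continuous_diffSymbol (c : ℝ) : Continuous (diffSymbol c) := by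
  unfold diffSymbol; fun_prop

theorem IsTest.continuous_dualGen {φ : Space → ℂ} (h : IsTest φ) (c : ℝ) :
    Continuous (dualGen c φ) := by
  have h1 : Continuous fun ξ => fderiv ℝ φ ξ ey :=
    (h.1.continuous_fderiv (by simp)).clm_apply continuous_const
  have h2 := h.continuous
  have h3 := continuous_diffSymbol c
  unfold dualGen
  fun_prop

theorem IsTest.hasCompactSupport_dualGen {φ : Space → ℂ} (h : IsTest φ) (c : ℝ) :
    HasCompactSupport (dualGen c φ) := by
  refine HasCompactSupport.intro h.2 fun ξ hξ => ?_
  have h1 : φ ξ = 0 := image_eq_zero_of_notMem_tsupport hξ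
  have h2 : fderiv ℝ φ ξ = 0 :=
    image_eq_zero_of_notMem_tsupport fun h => hξ (tsupport_fderiv_subset ℝ h)
  simp [dualGen, h1, h2]

theorem damping_shear_neg (c t : ℝ) (ξ : Space) :
    damping c t (shear (-t) ξ) = Complex.exp (-(c * (t * (ξ 0 ^ 2 + ξ 1 ^ 2 + ξ 2 ^ 2)
      - t ^ 2 * (ξ 0 * ξ 1) + t ^ 3 / 3 * ξ 0 ^ 2) : ℝ)) := by
  rw [damping, Complex.ofReal_exp]
  congr 2
  simp only [phase, shear_apply_zero, shear_apply_one, shear_apply_two]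
  push_cast
  ring

/-- Invariance of the test functions under the transposed flow allows a weak identity to be tested
against a moving test function. -/
theorem IsTest.dualEvo {φ : Space → ℂ} (h : IsTest φ) (c t : ℝ) : IsTest (dualEvo c t φ) := by
  constructor
  · have h1 : ContDiff ℝ ((⊤ : ℕ∞) : WithTop ℕ∞) fun ξ => φ (shear (-t) ξ) :=
      h.1.comp (shear (-t)).contDiff
    have h2 : ContDiff ℝ ((⊤ : ℕ∞) : WithTop ℕ∞) fun ξ : Space => (c * (t * (ξ 0 ^ 2 + ξ 1 ^ 2
        + ξ 2 ^ 2) - t ^ 2 * (ξ 0 * ξ 1) + t ^ 3 / 3 * ξ 0 ^ 2) : ℝ) := by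
      fun_prop
    have h3 : ContDiff ℝ ((⊤ : ℕ∞) : WithTop ℕ∞) fun ξ : Space => damping c t (shear (-t) ξ) := by
      simp only [damping_shear_neg]
      exact (Complex.ofRealCLM.contDiff.comp h2).neg.cexp
    exact h3.mul h1
  · exact HasCompactSupport.mul_left (h.2.comp_homeomorph (shearHomeomorph (-t)))

theorem shear_neg_add (t s : ℝ) (ξ : Space) : shear (-t) (ξ + s • ey) = shear (-t) ξ + s • ey := by
  rw [map_add, map_smul]
  congr 2
  exact ext_space (by simp) (by simp) (by simp)

theorem hasDerivAt_dualEvo (c t : ℝ) {φ : Space → ℂ} (hφ : Differentiable ℝ φ) (ξ : Space) :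
    HasDerivAt (fun s => dualEvo c s φ ξ) (dualEvo c t (dualGen c φ) ξ) t := by
  have h1 : HasDerivAt (fun s : ℝ => (c * (s * (ξ 0 ^ 2 + ξ 1 ^ 2 + ξ 2 ^ 2)
      - s ^ 2 * (ξ 0 * ξ 1) + s ^ 3 / 3 * ξ 0 ^ 2) : ℝ)) (diffSymbol c (shear (-t) ξ)) t := by
    have ha := ((hasDerivAt_id t).mul_const (ξ 0 ^ 2 + ξ 1 ^ 2 + ξ 2 ^ 2)).sub
      ((hasDerivAt_pow 2 t).mul_const (ξ 0 * ξ 1))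
    have hb := (((hasDerivAt_pow 3 t).div_const 3).mul_const (ξ 0 ^ 2))
    convert! (ha.add hb).const_mul c using 1
    simp only [diffSymbol, shear_apply_zero, shear_apply_one, shear_apply_two]
    push_cast
    ring
  have h2 : HasDerivAt (fun s => damping c s (shear (-s) ξ))
      (damping c t (shear (-t) ξ) * -(diffSymbol c (shear (-t) ξ) : ℂ)) t := by
    simp only [damping_shear_neg c _ ξ]
    exact h1.ofReal_comp.neg.cexp
  have h3 : HasDerivAt (fun s : ℝ => shear (-s) ξ) (-(ξ 0) • ey) t := by
    have : HasDerivAt (fun s : ℝ => ξ + (-s * ξ 0) • ey) ((-1 * ξ 0) • ey) t :=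
      (((hasDerivAt_id t).neg.mul_const (ξ 0)).smul_const ey).const_add ξ
    simpa [shear_apply, ey] using this
  have h4 : HasDerivAt (fun s : ℝ => φ (shear (-s) ξ))
      (fderiv ℝ φ (shear (-t) ξ) (-(ξ 0) • ey)) t :=
    (hφ _).hasFDerivAt.comp_hasDerivAt t h3
  convert! h2.mul h4 using 1
  simp only [CouetteCoriolis.dualEvo, dualGen, shear_apply_zero, map_smul, Complex.real_smul]
  push_cast
  ring

/-- Together with `hasDerivAt_dualEvo` this gives both forms of the evolution equation. The form
with `dualGen` outermost is the one to which `IsWeakGen` applies. -/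
theorem dualGen_dualEvo (c t : ℝ) {φ : Space → ℂ} (hφ : IsTest φ) :
    dualGen c (dualEvo c t φ) = dualEvo c t (dualGen c φ) := by
  ext ξ
  have h1 : HasDerivAt (fun s : ℝ => (c * (t * ((ξ + s • ey) 0 ^ 2 + (ξ + s • ey) 1 ^ 2
      + (ξ + s • ey) 2 ^ 2) - t ^ 2 * ((ξ + s • ey) 0 * (ξ + s • ey) 1)
      + t ^ 3 / 3 * (ξ + s • ey) 0 ^ 2) : ℝ)) (c * (2 * t * ξ 1 - t ^ 2 * ξ 0)) 0 := by
    have ha : HasDerivAt (fun s : ℝ => ξ 1 + s) 1 0 := (hasDerivAt_id _).const_add _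
    have hb := ((((ha.pow 2).const_add (ξ 0 ^ 2)).add_const (ξ 2 ^ 2)).const_mul t).sub
      ((ha.const_mul (ξ 0)).const_mul (t ^ 2))
    convert! (hb.add_const (t ^ 3 / 3 * ξ 0 ^ 2)).const_mul c using 1
    · ext s; simp
    · push_cast; ring
  have h2 : HasDerivAt (fun s : ℝ => damping c t (shear (-t) (ξ + s • ey)))
      (damping c t (shear (-t) ξ) * -((c * (2 * t * ξ 1 - t ^ 2 * ξ 0) : ℝ) : ℂ)) 0 := by
    simp only [damping_shear_neg]
    have := h1.ofReal_comp.neg.cexp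
    simpa using this
  have h4 : HasDerivAt (fun s : ℝ => φ (shear (-t) (ξ + s • ey)))
      (fderiv ℝ φ (shear (-t) ξ) ey) 0 := by
    simp only [shear_neg_add]
    exact (hφ.differentiable _).hasFDerivAt.hasLineDerivAt ey
  have h5 : HasDerivAt (fun s : ℝ => dualEvo c t φ (ξ + s • ey))
      (fderiv ℝ (dualEvo c t φ) ξ ey) 0 :=
    ((hφ.dualEvo c t).differentiable _).hasFDerivAt.hasLineDerivAt ey
  have h6 := h5.unique (h2.mul h4)
  rw [dualGen, h6]
  simp only [CouetteCoriolis.dualEvo, dualGen, shear_apply_zero, zero_smul, add_zero, diffSymbol,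
    shear_apply_one, shear_apply_two]
  push_cast
  ring

/-- For `|t| ≤ T` all supports lie in the image of the compact set `[-T, T] × tsupport g` under the
flow, which gives a dominating function independent of `t`. -/
theorem exists_bound_dualEvo (c T : ℝ) {g : Space → ℂ} (hg : Continuous g)
    (hg' : HasCompactSupport g) : ∃ (K : Set Space) (C : ℝ), IsCompact K ∧
      ∀ t, |t| ≤ T → ∀ ξ, ‖dualEvo c t g ξ‖ ≤ K.indicator (fun _ => C) ξ := by
  obtain ⟨K, hK, hKmem⟩ : ∃ K : Set Space, IsCompact K ∧
      ∀ t ∈ Set.Icc (-T) T, ∀ η ∈ tsupport g, shear t η ∈ K :=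
    ⟨_, (isCompact_Icc.prod (s := Set.Icc (-T) T) hg').image continuous_shear_uncurry,
      fun t ht η hη => ⟨(t, η), ⟨ht, hη⟩, rfl⟩⟩
  have hcont : Continuous fun p : ℝ × Space => dualEvo c p.1 g p.2 := by
    have h1 : Continuous fun p : ℝ × Space => shear (-p.1) p.2 :=
      by simp only [shear_apply]; fun_prop
    have h2 : Continuous fun p : ℝ × Space => damping c p.1 (shear (-p.1) p.2) :=
      (continuous_damping_uncurry c).comp (continuous_fst.prodMk h1)
    have h3 : Continuous fun p : ℝ × Space => g (shear (-p.1) p.2) := hg.comp h1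
    exact Continuous.mul h2 h3
  obtain ⟨C, hC⟩ := (isCompact_Icc.prod hK).exists_bound_of_continuousOn
    (s := Set.Icc (-T) T ×ˢ K) hcont.continuousOn
  refine ⟨K, C, hK, fun t ht ξ => ?_⟩
  have ht' : t ∈ Set.Icc (-T) T := abs_le.1 ht
  by_cases hξ : ξ ∈ K
  · rw [Set.indicator_of_mem hξ]
    exact hC (t, ξ) ⟨ht', hξ⟩
  · rw [Set.indicator_of_notMem hξ]
    have : shear (-t) ξ ∉ tsupport g := fun h =>
      hξ (shear_shear_neg t ξ ▸ hKmem t ht' _ h)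
    simp [CouetteCoriolis.dualEvo, image_eq_zero_of_notMem_tsupport this]

theorem locallyIntegrable_L2 (u : L2) : LocallyIntegrable u (volume : Measure Space) :=
  (Lp.memLp u).locallyIntegrable (by norm_num)

theorem tendsto_coe_nhdsGT : Tendsto (fun t : ℝ≥0 => (t : ℝ)) (𝓝[>] 0) (𝓝[≠] 0) := by
  refine tendsto_nhdsWithin_iff.2 ⟨?_, ?_⟩
  · exact (NNReal.continuous_coe.tendsto 0).mono_left nhdsWithin_le_nhds
  · filter_upwards [self_mem_nhdsWithin] with t ht
    exact (NNReal.coe_pos.2 ht).ne'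

/-- Local integrability of `w` is the right generality: it is applied to `w = u` and, in the energy
estimate, to `w = |u|²`. -/
theorem hasDerivAt_integral_dualEvo (c : ℝ) {φ : Space → ℂ} (hφ : IsTest φ) {w : Space → ℂ}
    (hw : LocallyIntegrable w volume) (t : ℝ) :
    HasDerivAt (fun s => ∫ ξ, dualEvo c s φ ξ * w ξ)
      (∫ ξ, dualEvo c t (dualGen c φ) ξ * w ξ) t := by
  obtain ⟨K, C, hK, hC⟩ := exists_bound_dualEvo c (|t| + 1) (hφ.continuous_dualGen c)
    (hφ.hasCompactSupport_dualGen c)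
  have hm : ∀ s, AEStronglyMeasurable (fun ξ => dualEvo c s φ ξ * w ξ) volume := fun s =>
    (hφ.dualEvo c s).continuous.aestronglyMeasurable.mul hw.aestronglyMeasurable
  refine (hasDerivAt_integral_of_dominated_loc_of_deriv_le (μ := (volume : Measure Space))
    (F := fun s ξ => dualEvo c s φ ξ * w ξ)
    (F' := fun s ξ => dualEvo c s (dualGen c φ) ξ * w ξ)
    (bound := K.indicator fun ξ => C * ‖w ξ‖) (Metric.ball_mem_nhds t one_pos)
    (Eventually.of_forall hm) ?_ ?_ ?_ ?_ ?_).2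
  · exact hw.integrable_smul_left_of_hasCompactSupport (hφ.dualEvo c t).continuous
      (hφ.dualEvo c t).2
  · rw [← dualGen_dualEvo c t hφ]
    exact ((hφ.dualEvo c t).continuous_dualGen c).aestronglyMeasurable.mul
      hw.aestronglyMeasurable
  · refine ae_of_all _ fun ξ s hs => ?_
    have hs' : |s| ≤ |t| + 1 := by
      rw [Metric.mem_ball, Real.dist_eq] at hs
      have := abs_sub_abs_le_abs_sub s t
      linarith
    have := hC s hs' ξ
    rw [norm_mul]
    by_cases hξ : ξ ∈ K
    · rw [Set.indicator_of_mem hξ] at this ⊢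
      gcongr
    · rw [Set.indicator_of_notMem hξ] at this ⊢
      rw [le_antisymm this (norm_nonneg _), zero_mul]
  · rw [integrable_indicator_iff hK.measurableSet]
    exact (hw.integrableOn_isCompact hK).norm.const_mul C
  · exact ae_of_all _ fun ξ s _ => (hasDerivAt_dualEvo c s hφ.differentiable ξ).mul_const _

theorem eq_of_integral_test {u v : L2} (h : ∀ φ, IsTest φ → ∫ ξ, φ ξ * u ξ = ∫ ξ, φ ξ * v ξ) :
    u = v := by
  refine Lp.ext (ae_eq_of_integral_contDiff_smul_eq (locallyIntegrable_L2 u) (locallyIntegrable_L2 v)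
    fun g hg hg' => ?_)
  have := h (fun ξ => (g ξ : ℂ))
    ⟨Complex.ofRealCLM.contDiff.comp hg, hg'.comp_left (g := fun x : ℝ => (x : ℂ)) rfl⟩
  simpa [Complex.real_smul] using this

/-- `g` is the image of `u` under the generator, in the sense of distributions. -/
def IsWeakGen (c : ℝ) (u g : L2) : Prop :=
  ∀ φ, IsTest φ → ∫ ξ, φ ξ * g ξ = ∫ ξ, dualGen c φ ξ * u ξ

theorem tendsto_iff_isWeakGen {c : ℝ} (hc : 0 ≤ c) (u g : L2) :
    Tendsto (fun t : ℝ≥0 => ((t : ℝ)⁻¹ : ℂ) • ((fourierSemigroup hc).op t u - u)) (𝓝[>] 0) (𝓝 g)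
      ↔ IsWeakGen c u g := by
  have hp : ∀ φ (hφ : IsTest φ) (t : ℝ≥0), pairing hφ.memLp ((fourierSemigroup hc).op t u) =
      ∫ ξ, dualEvo c t φ ξ * u ξ := fun φ hφ t => by
    rw [pairing_apply, integral_mul_evolution]; rfl
  constructor
  · intro h φ hφ
    have h1 := ((pairing hφ.memLp).continuous.tendsto g).comp h
    have h2 := (hasDerivAt_integral_dualEvo c hφ (locallyIntegrable_L2 u) 0).tendsto_slope_zero
    have h4 := h2.comp tendsto_coe_nhdsGT
    rw [dualEvo_zero, dualEvo_zero] at h4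
    rw [pairing_apply] at h1
    refine tendsto_nhds_unique h1 (h4.congr fun t => ?_)
    simp only [Function.comp_apply, zero_add, map_smul, map_sub, hp φ hφ,
      pairing_apply hφ.memLp u]
    rw [← Complex.ofReal_inv, Complex.coe_smul]
  · intro h
    have hS := isContraction_fourierSemigroup hc
    -- With `B = id`, `l = 0` and constant `w = g` this says `t⁻¹ ∫₀ᵗ S(r)g dr → g`. It remains to
    -- identify the integral with `S(t)u - u`, which is done against test functions.
    have h1 := C0Semigroup.tendsto_volterra_average hS (ContinuousLinearMap.id ℂ L2) 0
      (continuous_const (y := g))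
    refine h1.congr fun t => ?_
    congr 1
    refine eq_of_integral_test fun φ hφ => ?_
    have hc1 := C0Semigroup.continuous_volterraIntegrand_right hS (ContinuousLinearMap.id ℂ L2) 0
      (continuous_const (y := g)) t
    rw [← pairing_apply hφ.memLp, ← pairing_apply hφ.memLp, map_sub, hp φ hφ]
    refine (ContinuousLinearMap.intervalIntegral_comp_comm (pairing hφ.memLp)
      (hc1.intervalIntegrable _ _)).symm.trans ?_
    -- The weak identity for the test function `dualEvo c r φ` turns the derivative of `⟨φ, S(r)u⟩`
    -- into `⟨φ, S(r)g⟩`.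
    have hd : ∀ r ∈ Set.uIcc (0 : ℝ) t, HasDerivAt (fun s => ∫ ξ, dualEvo c s φ ξ * u ξ)
        (pairing hφ.memLp (C0Semigroup.volterraIntegrand (fourierSemigroup hc)
          (ContinuousLinearMap.id ℂ L2) 0 (fun _ => g) t r)) r := by
      intro r hr
      rw [Set.uIcc_of_le t.coe_nonneg] at hr
      have h2 := hasDerivAt_integral_dualEvo c hφ (locallyIntegrable_L2 u) r
      rw [← dualGen_dualEvo c r hφ, ← h _ (hφ.dualEvo c r)] at h2
      convert h2 using 1
      rw [C0Semigroup.volterraIntegrand_zero, ContinuousLinearMap.id_apply, pairing_apply, integral_mul_evolution, Real.coe_toNNReal r hr.1]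
      rfl
    rw [intervalIntegral.integral_eq_sub_of_hasDerivAt hd
      (((pairing hφ.memLp).continuous.comp hc1).intervalIntegrable _ _)]
    simp only [dualEvo_zero]
    rw [pairing_apply]

theorem isClosed_setOf_isWeakGen (c : ℝ) : IsClosed {p : L2 × L2 | IsWeakGen c p.1 p.2} := by
  simp only [IsWeakGen, Set.ofPred_forall]
  refine isClosed_iInter fun φ => isClosed_iInter fun hφ => ?_
  have hG : MemLp (dualGen c φ) 2 (volume : Measure Space) :=
    (hφ.continuous_dualGen c).memLp_of_hasCompactSupport (hφ.hasCompactSupport_dualGen c)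
  simp only [← pairing_apply hφ.memLp, ← pairing_apply hG]
  exact isClosed_eq (by fun_prop) (by fun_prop)

/-! ### Regularity in the domain of the generator -/

/-- A smooth bump function on the real line. -/
def bump : ContDiffBump (0 : ℝ) := ⟨1, 2, one_pos, by norm_num⟩

/-- Since the cutoff is `bump (ε m)`, its derivative along the shear carries `ε m · bump'(ε m)`.
This bound is therefore uniform in `ε`. -/
theorem exists_bound_mul_deriv_bump : ∃ C, ∀ x : ℝ, |x * deriv bump x| ≤ C := by
  have h1 : Continuous fun x : ℝ => x * deriv bump x :=
    continuous_id.mul (bump.contDiff.continuous_deriv (n := 1) le_rfl)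
  have h2 : HasCompactSupport fun x : ℝ => x * deriv bump x :=
    HasCompactSupport.mul_left bump.hasCompactSupport.deriv
  exact h2.exists_bound_of_continuous h1

/-- A smooth cutoff on the frequency side. -/
def cutoff (c ε : ℝ) (ξ : Space) : ℝ := bump (ε * diffSymbol c ξ)

theorem cutoff_nonneg (c ε : ℝ) (ξ : Space) : 0 ≤ cutoff c ε ξ := bump.nonneg

theorem cutoff_le_one (c ε : ℝ) (ξ : Space) : cutoff c ε ξ ≤ 1 := bump.le_one

theorem contDiff_diffSymbol (c : ℝ) :
    ContDiff ℝ ((⊤ : ℕ∞) : WithTop ℕ∞) (diffSymbol c) := by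
  unfold diffSymbol; fun_prop

theorem diffSymbol_nonneg {c : ℝ} (hc : 0 ≤ c) (ξ : Space) : 0 ≤ diffSymbol c ξ := by
  unfold diffSymbol; positivity

theorem contDiff_cutoff (c ε : ℝ) : ContDiff ℝ ((⊤ : ℕ∞) : WithTop ℕ∞) (cutoff c ε) :=
  bump.contDiff.comp (contDiff_const.mul (contDiff_diffSymbol c))

theorem hasCompactSupport_cutoff {c ε : ℝ} (hc : 0 < c) (hε : 0 < ε) :
    HasCompactSupport (cutoff c ε) := by
  refine HasCompactSupport.intro (isCompact_closedBall (0 : Space) (1 + 2 / (ε * c))) fun ξ hξ => ?_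
  refine bump.zero_of_le_dist ?_
  rw [mem_closedBall_zero_iff, not_le] at hξ
  have h0 : 0 < 2 / (ε * c) := by positivity
  have h1 : 2 / (ε * c) ≤ ‖ξ‖ ^ 2 := by nlinarith
  rw [div_le_iff₀ (by positivity)] at h1
  have h2 : ε * diffSymbol c ξ = ‖ξ‖ ^ 2 * (ε * c) := by
    rw [norm_sq_space, diffSymbol]; ring
  rw [Real.dist_eq, sub_zero, h2]
  exact h1.trans (le_abs_self _)

theorem hasLineDerivAt_diffSymbol (c : ℝ) (ξ : Space) :
    HasLineDerivAt ℝ (diffSymbol c) (2 * c * ξ 1) ξ ey := by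
  have ha : HasDerivAt (fun s : ℝ => ξ 1 + s) 1 0 := (hasDerivAt_id _).const_add _
  have hb := (((ha.pow 2).const_add (ξ 0 ^ 2)).add_const (ξ 2 ^ 2)).const_mul c
  rw [HasLineDerivAt]
  convert! hb using 1
  · ext s; simp [diffSymbol]
  · push_cast; ring

theorem hasLineDerivAt_cutoff (c ε : ℝ) (ξ : Space) :
    HasLineDerivAt ℝ (cutoff c ε)
      (deriv bump (ε * diffSymbol c ξ) * (ε * (2 * c * ξ 1))) ξ ey := by
  have h1 : HasDerivAt bump (deriv bump (ε * diffSymbol c (ξ + (0 : ℝ) • ey)))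
      (ε * diffSymbol c (ξ + (0 : ℝ) • ey)) :=
    ((bump.contDiff (n := 1)).differentiable (by simp) _).hasDerivAt
  have h2 := (HasDerivAt.const_mul ε (hasLineDerivAt_diffSymbol c ξ))
  have := h1.comp (0 : ℝ) h2
  simp only [zero_smul, add_zero] at this
  exact this

theorem fderiv_ofReal_eq_of_hasLineDerivAt {a : Space → ℝ} {a' : ℝ} {ξ : Space}
    (ha : DifferentiableAt ℝ a ξ) (h : HasLineDerivAt ℝ a a' ξ ey) :
    fderiv ℝ (fun η => (a η : ℂ)) ξ ey = a' := by
  have h1 : HasLineDerivAt ℝ (fun η => (a η : ℂ)) (a' : ℂ) ξ ey := HasDerivAt.ofReal_comp h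
  have h2 : DifferentiableAt ℝ (fun η => (a η : ℂ)) ξ :=
    Complex.ofRealCLM.differentiableAt.comp ξ ha
  exact (h2.hasFDerivAt.hasLineDerivAt ey).unique h1

/-- By `2|ξ₀ξ₁| ≤ ξ₀² + ξ₁²`, the derivative of the symbol along the shear is dominated by the
symbol. The regularity argument hinges on this. -/
theorem abs_mul_le_diffSymbol {c : ℝ} (hc : 0 ≤ c) (ξ : Space) :
    |ξ 0 * (2 * c * ξ 1)| ≤ diffSymbol c ξ := by
  have h : diffSymbol c ξ - |ξ 0 * (2 * c * ξ 1)| = c * ((|ξ 0| - |ξ 1|) ^ 2 + ξ 2 ^ 2) := by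
    rw [abs_mul, abs_mul, abs_mul, abs_two, abs_of_nonneg hc, sub_sq, sq_abs, sq_abs, diffSymbol]
    ring
  have : 0 ≤ c * ((|ξ 0| - |ξ 1|) ^ 2 + ξ 2 ^ 2) := by positivity
  linarith

/-- The weight in the energy estimate. -/
def weight (c ε : ℝ) (ξ : Space) : ℝ := diffSymbol c ξ * cutoff c ε ξ ^ 2

theorem contDiff_weight (c ε : ℝ) : ContDiff ℝ ((⊤ : ℕ∞) : WithTop ℕ∞) (weight c ε) :=
  (contDiff_diffSymbol c).mul ((contDiff_cutoff c ε).pow 2)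

theorem isTest_weight {c ε : ℝ} (hc : 0 < c) (hε : 0 < ε) :
    IsTest fun ξ => (weight c ε ξ : ℂ) := by
  refine ⟨Complex.ofRealCLM.contDiff.comp (contDiff_weight c ε), ?_⟩
  refine HasCompactSupport.comp_left (g := fun x : ℝ => (x : ℂ)) ?_ rfl
  refine (hasCompactSupport_cutoff hc hε).mono fun ξ h => ?_
  simp only [weight, Function.mem_support, ne_eq, mul_eq_zero, not_or] at h ⊢
  exact fun h0 => h.2 (by rw [h0]; norm_num)

/-- The derivative of the weight along the shear. -/
def weightDeriv (c ε : ℝ) (ξ : Space) : ℝ :=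
  ξ 0 * (2 * c * ξ 1) * (cutoff c ε ξ ^ 2 + 2 * cutoff c ε ξ *
    (ε * diffSymbol c ξ * deriv bump (ε * diffSymbol c ξ)))

theorem dualGen_weight (c ε : ℝ) (ξ : Space) :
    dualGen (2 * c) (fun η => (weight c ε η : ℂ)) ξ =
      ((-(2 * (diffSymbol c ξ * cutoff c ε ξ) ^ 2 + weightDeriv c ε ξ) : ℝ) : ℂ) := by
  have h1 : HasLineDerivAt ℝ (weight c ε) _ ξ ey :=
    HasDerivAt.mul (hasLineDerivAt_diffSymbol c ξ) (HasDerivAt.pow (hasLineDerivAt_cutoff c ε ξ) 2)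
  rw [dualGen, fderiv_ofReal_eq_of_hasLineDerivAt
    ((contDiff_weight c ε).differentiable (by simp) ξ) h1, weightDeriv, weight]
  have h2 : diffSymbol (2 * c) ξ = 2 * diffSymbol c ξ := by simp only [diffSymbol]; ring
  rw [h2]
  simp only [zero_smul, add_zero]
  push_cast
  ring

/-- The derivative is at most `m χ (1 + 2C)`, linear in `m χ`; Young's inequality lets the
dissipation absorb it. -/
theorem abs_weightDeriv_le {c ε C : ℝ} (hc : 0 ≤ c) (hC : ∀ x : ℝ, |x * deriv bump x| ≤ C)
    (ξ : Space) : |weightDeriv c ε ξ| ≤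
      1 / 2 * (diffSymbol c ξ * cutoff c ε ξ) ^ 2 + 1 / 2 * (1 + 2 * C) ^ 2 := by
  have h1 := abs_mul_le_diffSymbol hc ξ
  have h2 := hC (ε * diffSymbol c ξ)
  have h3 := cutoff_nonneg c ε ξ
  have h4 := cutoff_le_one c ε ξ
  have h5 := diffSymbol_nonneg hc ξ
  have h6 : |cutoff c ε ξ ^ 2 + 2 * cutoff c ε ξ *
      (ε * diffSymbol c ξ * deriv bump (ε * diffSymbol c ξ))| ≤
      cutoff c ε ξ * (1 + 2 * C) := by
    refine (abs_add_le _ _).trans ?_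
    rw [abs_mul, abs_mul, abs_of_nonneg (sq_nonneg (cutoff c ε ξ)), abs_two, abs_of_nonneg h3]
    nlinarith [mul_le_mul_of_nonneg_left h2 h3]
  have h7 : |weightDeriv c ε ξ| ≤ diffSymbol c ξ * (cutoff c ε ξ * (1 + 2 * C)) := by
    rw [weightDeriv, abs_mul]
    exact mul_le_mul h1 h6 (abs_nonneg _) h5
  nlinarith [sq_nonneg (diffSymbol c ξ * cutoff c ε ξ - (1 + 2 * C))]

/-! ### The weighted energy identity and estimate -/

theorem IsTest.memLp_top {φ : Space → ℂ} (h : IsTest φ) : MemLp φ ∞ (volume : Measure Space) :=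
  h.continuous.memLp_of_hasCompactSupport h.2

theorem norm_sq_L2 (u : L2) : ‖u‖ ^ 2 = ∫ ξ, ‖u ξ‖ ^ 2 := by
  have h2 : ∀ ξ, inner ℂ (u ξ) (u ξ) = ((‖u ξ‖ ^ 2 : ℝ) : ℂ) := fun ξ => by
    rw [inner_self_eq_norm_sq_to_K]; simp
  rw [← inner_self_eq_norm_sq (𝕜 := ℂ) u, L2.inner_def]
  simp_rw [h2]
  rw [integral_complex_ofReal]
  rfl

theorem integrable_norm_sq_L2 (u : L2) : Integrable fun ξ => ‖u ξ‖ ^ 2 :=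
  (memLp_two_iff_integrable_sq_norm (Lp.aestronglyMeasurable u)).1 (Lp.memLp u)

theorem inner_mulOp_left {a : Space → ℝ} (ha : MemLp (fun ξ => (a ξ : ℂ)) ∞ volume) (u v : L2) :
    inner ℂ (mulOp ha u) v = inner ℂ u (mulOp ha v) := by
  rw [L2.inner_def, L2.inner_def]
  refine integral_congr_ae ?_
  filter_upwards [mulOp_ae ha u, mulOp_ae ha v] with ξ h1 h2
  rw [h1, h2, RCLike.inner_apply, RCLike.inner_apply, map_mul, Complex.conj_ofReal]
  ring

theorem inner_mulOp_self {a : Space → ℝ} (ha : MemLp (fun ξ => (a ξ : ℂ)) ∞ volume) (u : L2) :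
    inner ℂ u (mulOp ha u) = ∫ ξ, (a ξ : ℂ) * ((‖u ξ‖ ^ 2 : ℝ) : ℂ) := by
  rw [L2.inner_def]
  refine integral_congr_ae ?_
  filter_upwards [mulOp_ae ha u] with ξ h1
  rw [h1, RCLike.inner_apply, mul_assoc, RCLike.mul_conj]
  simp

/-- The density `|S(t)u|²` is transported by the same shear with the damping squared, hence the
symbol constant `2c`. -/
theorem inner_evolution_weight {c : ℝ} (hc : 0 ≤ c) {a : Space → ℝ}
    (ha : MemLp (fun ξ => (a ξ : ℂ)) ∞ volume) (u : L2) (t : ℝ≥0) :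
    inner ℂ ((fourierSemigroup hc).op t u) (mulOp ha ((fourierSemigroup hc).op t u)) =
      ∫ ξ, dualEvo (2 * c) t (fun ξ => (a ξ : ℂ)) ξ * ((‖u ξ‖ ^ 2 : ℝ) : ℂ) := by
  rw [inner_mulOp_self, ← integral_comp_shear t
    fun ξ => dualEvo (2 * c) t (fun ξ => (a ξ : ℂ)) ξ * ((‖u ξ‖ ^ 2 : ℝ) : ℂ)]
  refine integral_congr_ae ?_
  filter_upwards [evolution_ae hc t u] with ξ h
  have h1 : damping (2 * c) t ξ = ((‖damping c t ξ‖ ^ 2 : ℝ) : ℂ) := by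
    rw [norm_damping, damping, ← Real.exp_nat_mul]
    congr 2
    simp only [phase]
    push_cast
    ring
  rw [dualEvo, shear_neg_shear, h1]
  change _ * ((‖evolution hc t u ξ‖ ^ 2 : ℝ) : ℂ) = _
  rw [h, norm_mul]
  push_cast
  ring

/-- Differentiate `⟨S(t)u, a S(t)u⟩` at `t = 0` twice over: on the weight through the transposed
flow of `|u|²`, and on `u` by the product rule. -/
theorem IsWeakGen.integral_dualGen {c : ℝ} (hc : 0 ≤ c) {u g : L2} (h : IsWeakGen c u g)
    {a : Space → ℝ} (ha : IsTest fun ξ => (a ξ : ℂ)) :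
    ∫ ξ, dualGen (2 * c) (fun ξ => (a ξ : ℂ)) ξ * ((‖u ξ‖ ^ 2 : ℝ) : ℂ) =
      inner ℂ g (mulOp ha.memLp_top u) + inner ℂ (mulOp ha.memLp_top u) g := by
  have hw : LocallyIntegrable (fun ξ => ((‖u ξ‖ ^ 2 : ℝ) : ℂ)) volume :=
    (integrable_norm_sq_L2 u).ofReal.locallyIntegrable
  have h2 := (hasDerivAt_integral_dualEvo (2 * c) ha hw 0).tendsto_slope_zero.comp
    tendsto_coe_nhdsGT
  rw [dualEvo_zero, dualEvo_zero] at h2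
  refine tendsto_nhds_unique h2 ?_
  have hd := (tendsto_iff_isWeakGen hc u g).2 h
  set S := fourierSemigroup hc
  set M := mulOp ha.memLp_top
  have hMS : Tendsto (fun t => M (S.op t u)) (𝓝[>] 0) (𝓝 (M u)) :=
    (M.continuous.tendsto u).comp (S.tendsto_op u)
  refine ((hd.inner (𝕜 := ℂ) hMS).add (tendsto_const_nhds.inner (𝕜 := ℂ) hd)).congr fun t => ?_
  have e1 := inner_evolution_weight hc ha.memLp_top u t
  have e0 := inner_evolution_weight hc ha.memLp_top u 0
  rw [S.op_zero_apply] at e0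
  rw [NNReal.coe_zero, dualEvo_zero] at e0
  simp only [Function.comp_apply, zero_add]
  rw [← e1, ← e0, ← Complex.ofReal_inv, inner_smul_left, inner_smul_right, Complex.conj_ofReal,
    ← mul_add, inner_sub_left, inner_sub_right, inner_mulOp_left, inner_mulOp_left,
    ← Complex.coe_smul, smul_eq_mul]
  ring

theorem isTest_symbol_cutoff {c ε : ℝ} (hc : 0 < c) (hε : 0 < ε) :
    IsTest fun ξ => ((diffSymbol c ξ * cutoff c ε ξ : ℝ) : ℂ) := by
  refine ⟨Complex.ofRealCLM.contDiff.comp ((contDiff_diffSymbol c).mul (contDiff_cutoff c ε)), ?_⟩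
  exact HasCompactSupport.comp_left (g := fun x : ℝ => (x : ℂ))
    (HasCompactSupport.mul_left (hasCompactSupport_cutoff hc hε)) rfl

theorem IsWeakGen.norm_symbol_cutoff_le {c ε C : ℝ} (hc : 0 < c) (hε : 0 < ε)
    (hC : ∀ x : ℝ, |x * deriv bump x| ≤ C) {u g : L2} (h : IsWeakGen c u g) :
    ‖mulOp (isTest_symbol_cutoff hc hε).memLp_top u‖ ^ 2 ≤
      1 / 2 * (1 + 2 * C) ^ 2 * ‖u‖ ^ 2 + 2 * ‖g‖ ^ 2 := by
  set N := mulOp (isTest_symbol_cutoff hc hε).memLp_top u with hN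
  set M := mulOp (isTest_weight hc hε).memLp_top u with hM
  have hNsq : ‖N‖ ^ 2 = ∫ ξ, (diffSymbol c ξ * cutoff c ε ξ) ^ 2 * ‖u ξ‖ ^ 2 := by
    rw [norm_sq_L2]
    refine integral_congr_ae ?_
    filter_upwards [mulOp_ae (isTest_symbol_cutoff hc hε).memLp_top u] with ξ h1
    rw [hN, h1, norm_mul, Complex.norm_real, mul_pow, Real.norm_eq_abs, sq_abs]
  have hMN : ‖M‖ ≤ ‖N‖ := by
    refine Lp.norm_le_norm_of_ae_le ?_
    filter_upwards [mulOp_ae (isTest_symbol_cutoff hc hε).memLp_top u,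
      mulOp_ae (isTest_weight hc hε).memLp_top u] with ξ h1 h2
    rw [hN, hM, h1, h2, norm_mul, norm_mul, Complex.norm_real, Complex.norm_real, weight]
    have h3 := cutoff_nonneg c ε ξ
    have h4 := cutoff_le_one c ε ξ
    have h5 := diffSymbol_nonneg hc.le ξ
    rw [Real.norm_of_nonneg (by positivity), Real.norm_of_nonneg (by positivity)]
    gcongr
    nlinarith
  have hI := integrable_norm_sq_L2 u
  have hIN : Integrable fun ξ => (diffSymbol c ξ * cutoff c ε ξ) ^ 2 * ‖u ξ‖ ^ 2 := by
    refine hI.locallyIntegrable.integrable_smul_left_of_hasCompactSupport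
      (g := fun ξ => (diffSymbol c ξ * cutoff c ε ξ) ^ 2) ?_ ?_
    · exact ((continuous_diffSymbol c).mul (contDiff_cutoff c ε).continuous).pow 2
    · exact HasCompactSupport.comp_left (g := fun x : ℝ => x ^ 2)
        (HasCompactSupport.mul_left (hasCompactSupport_cutoff hc hε)) (by norm_num)
  have key := h.integral_dualGen hc.le (isTest_weight hc hε)
  simp_rw [dualGen_weight, ← Complex.ofReal_mul] at key
  rw [integral_complex_ofReal] at key
  have hre := congrArg Complex.re key
  rw [Complex.ofReal_re, Complex.add_re] at hre
  have b1 : -(‖g‖ * ‖N‖) ≤ (inner ℂ g M).re := by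
    have := (abs_le.1 ((Complex.abs_re_le_norm _).trans (norm_inner_le_norm (𝕜 := ℂ) g M))).1
    have h2 := mul_le_mul_of_nonneg_left hMN (norm_nonneg g)
    linarith
  have b2 : -(‖g‖ * ‖N‖) ≤ (inner ℂ M g).re := by
    have := (abs_le.1 ((Complex.abs_re_le_norm _).trans (norm_inner_le_norm (𝕜 := ℂ) M g))).1
    have h2 := mul_le_mul_of_nonneg_left hMN (norm_nonneg g)
    linarith
  -- Of the dissipation `2(m χ)²`, one half of `(m χ)²` is spent on the derivative of the weight;
  -- `3/2` remains.
  have b3 : ∫ ξ, -(2 * (diffSymbol c ξ * cutoff c ε ξ) ^ 2 + weightDeriv c ε ξ) * ‖u ξ‖ ^ 2 ≤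
      ∫ ξ, (-(3 / 2) * ((diffSymbol c ξ * cutoff c ε ξ) ^ 2 * ‖u ξ‖ ^ 2) +
        1 / 2 * (1 + 2 * C) ^ 2 * ‖u ξ‖ ^ 2) := by
    have hG : Integrable fun ξ =>
        ((-(2 * (diffSymbol c ξ * cutoff c ε ξ) ^ 2 + weightDeriv c ε ξ) * ‖u ξ‖ ^ 2 : ℝ) : ℂ) := by
      have hw : LocallyIntegrable (fun ξ => ((‖u ξ‖ ^ 2 : ℝ) : ℂ)) volume :=
        hI.ofReal.locallyIntegrable
      have := hw.integrable_smul_left_of_hasCompactSupport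
        ((isTest_weight hc hε).continuous_dualGen (2 * c))
        ((isTest_weight hc hε).hasCompactSupport_dualGen (2 * c))
      refine this.congr (ae_of_all _ fun ξ => ?_)
      simp only [dualGen_weight, smul_eq_mul, Complex.ofReal_mul]
    refine integral_mono hG.re ((hIN.const_mul _).add (hI.const_mul _)) fun ξ => ?_
    have h1 := (abs_le.1 (abs_weightDeriv_le (ε := ε) hc.le hC ξ)).1
    have h2 : -(2 * (diffSymbol c ξ * cutoff c ε ξ) ^ 2 + weightDeriv c ε ξ) ≤
      -(3 / 2) * (diffSymbol c ξ * cutoff c ε ξ) ^ 2 + 1 / 2 * (1 + 2 * C) ^ 2 := by linarith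
    have h3 := mul_le_mul_of_nonneg_right h2 (sq_nonneg ‖u ξ‖)
    refine le_trans (le_of_eq ?_) (h3.trans (le_of_eq ?_))
    · simp
    · ring
  rw [integral_add (hIN.const_mul _) (hI.const_mul _), integral_const_mul, integral_const_mul,
    ← hNsq, ← norm_sq_L2] at b3
  -- Here `2‖g‖‖N‖ ≤ ‖N‖²/2 + 2‖g‖²` absorbs another half and leaves coefficient `1`.
  nlinarith [sq_nonneg (‖N‖ - 2 * ‖g‖)]

/-- The cutoff bound does not depend on `ε`. At each fixed `ξ` the cutoff is eventually `1`, so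
Fatou's lemma applies. -/
theorem IsWeakGen.memLp_diffSymbol_mul {c : ℝ} (hc : 0 < c) {u g : L2} (h : IsWeakGen c u g) :
    MemLp (fun ξ => (diffSymbol c ξ : ℂ) * u ξ) 2 volume := by
  obtain ⟨C, hC⟩ := exists_bound_mul_deriv_bump
  set R := 1 / 2 * (1 + 2 * C) ^ 2 * ‖u‖ ^ 2 + 2 * ‖g‖ ^ 2
  have hε : ∀ n : ℕ, (0 : ℝ) < 1 / ((n : ℝ) + 1) := fun n => Nat.one_div_pos_of_nat
  refine ⟨(Complex.continuous_ofReal.comp (continuous_diffSymbol c)).aestronglyMeasurable.mul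
    (Lp.aestronglyMeasurable u), ?_⟩
  refine (Lp.eLpNorm_lim_le_liminf_eLpNorm (f := fun (n : ℕ) =>
    (mulOp (isTest_symbol_cutoff hc (hε n)).memLp_top u : Space → ℂ))
    (fun n => Lp.aestronglyMeasurable _) _ ?_).trans_lt ?_
  · have hall := ae_all_iff.2 fun n : ℕ =>
      mulOp_ae (isTest_symbol_cutoff hc (hε n)).memLp_top u
    filter_upwards [hall] with ξ hξ
    refine tendsto_const_nhds.congr' ?_
    have hev : Tendsto (fun n : ℕ => 1 / ((n : ℝ) + 1) * diffSymbol c ξ) atTop (𝓝 0) := by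
      simpa using (tendsto_one_div_add_atTop_nhds_zero_nat (𝕜 := ℝ)).mul_const (diffSymbol c ξ)
    filter_upwards [hev.eventually bump.eventuallyEq_one] with n hn
    have : cutoff c (1 / ((n : ℝ) + 1)) ξ = 1 := hn
    rw [hξ n, this, mul_one]
  · refine (liminf_le_of_frequently_le' (x := ENNReal.ofReal (√R))
      (Frequently.of_forall fun n => ?_)).trans_lt ENNReal.ofReal_lt_top
    have h1 := h.norm_symbol_cutoff_le hc (hε n) hC
    have h2 := Real.le_sqrt_of_sq_le h1
    rw [Lp.norm_def] at h2
    exact (ENNReal.le_ofReal_iff_toReal_le (Lp.eLpNorm_ne_top _) (Real.sqrt_nonneg _)).2 h2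

/-! ### The scalar operator on the Fourier side -/

theorem IsTest.of_schwartz_mul_cutoff {c ε : ℝ} (hc : 0 < c) (hε : 0 < ε) (ψ : 𝓢(Space, ℂ)) :
    IsTest fun ξ => (cutoff c ε ξ : ℂ) * ψ ξ :=
  ⟨(Complex.ofRealCLM.contDiff.comp (contDiff_cutoff c ε)).mul (ψ.smooth ⊤),
    HasCompactSupport.mul_right ((hasCompactSupport_cutoff hc hε).comp_left
      (g := fun x : ℝ => (x : ℂ)) rfl)⟩

theorem hasTemperateGrowth_coord (i : Fin 3) :
    (fun ξ : Space => ((ξ i : ℝ) : ℂ)).HasTemperateGrowth := by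
  have h : (fun ξ : Space => (ξ i : ℝ)).HasTemperateGrowth :=
    (EuclideanSpace.proj i : Space →L[ℝ] ℝ).hasTemperateGrowth
  exact Complex.ofRealCLM.hasTemperateGrowth.comp h

/-- The symbol `-4π²|ξ|²` of the Laplacian. -/
def laplacianSymbol (ξ : Space) : ℂ := ((-(4 * Real.pi ^ 2 * ‖ξ‖ ^ 2) : ℝ) : ℂ)

theorem hasTemperateGrowth_laplacianSymbol : laplacianSymbol.HasTemperateGrowth := by
  unfold laplacianSymbol
  fun_prop

/-- Multiplication by the symbol of the Laplacian. -/
def schwartzLaplacian (ψ : 𝓢(Space, ℂ)) : 𝓢(Space, ℂ) := SchwartzMap.smulLeftCLM ℂ laplacianSymbol ψ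

/-- The transpose of the shear on the Fourier side. -/
def schwartzShear (ψ : 𝓢(Space, ℂ)) : 𝓢(Space, ℂ) :=
  SchwartzMap.smulLeftCLM ℂ (fun ξ : Space => ((ξ 0 : ℝ) : ℂ)) (∂_{ey} ψ)

theorem schwartzLaplacian_apply (ψ : 𝓢(Space, ℂ)) (ξ : Space) :
    schwartzLaplacian ψ ξ = laplacianSymbol ξ * ψ ξ := by
  rw [schwartzLaplacian, SchwartzMap.smulLeftCLM_apply_apply hasTemperateGrowth_laplacianSymbol,
    smul_eq_mul]

theorem schwartzShear_apply (ψ : 𝓢(Space, ℂ)) (ξ : Space) :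
    schwartzShear ψ ξ = (ξ 0 : ℂ) * fderiv ℝ ψ ξ ey := by
  rw [schwartzShear, SchwartzMap.smulLeftCLM_apply_apply (hasTemperateGrowth_coord 0), smul_eq_mul,
    SchwartzMap.lineDerivOp_apply_eq_fderiv]

theorem dualGen_schwartz (ν : ℝ) (ψ : 𝓢(Space, ℂ)) :
    dualGen (4 * Real.pi ^ 2 * ν) ψ = (ν : ℂ) • ⇑(schwartzLaplacian ψ) - ⇑(schwartzShear ψ) := by
  ext ξ
  rw [Pi.sub_apply, Pi.smul_apply, schwartzLaplacian_apply, schwartzShear_apply, dualGen,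
    laplacianSymbol, norm_sq_space, diffSymbol, smul_eq_mul]
  push_cast
  ring

theorem toDistr_fourier (u : L2) (ψ : 𝓢(Space, ℂ)) :
    toDistr u (𝓕 ψ) = pairing (ψ.memLp 2) (𝓕 u) := by
  have h := Lp.fourier_toTemperedDistribution_eq u
  have h2 := congrArg (fun T : 𝓢'(Space, ℂ) => T ψ) h
  simp only [TemperedDistribution.fourier_apply, Lp.toTemperedDistribution_apply] at h2
  rw [pairing_apply]
  refine Eq.trans ?_ h2
  exact Lp.toTemperedDistribution_apply u (𝓕 ψ)

theorem laplacian_fourier (ψ : 𝓢(Space, ℂ)) : Δ (𝓕 ψ) = 𝓕 (schwartzLaplacian ψ) := by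
  have hin : ∀ i : Fin 3, ∀ ξ : Space,
      inner ℝ ξ (EuclideanSpace.basisFun (Fin 3) ℝ i) = ξ i := fun i ξ => by
    simp [EuclideanSpace.inner_single_right]
  have hg : ∀ i : Fin 3, (fun ξ : Space => ξ i).HasTemperateGrowth := fun i =>
    (EuclideanSpace.proj i : Space →L[ℝ] ℝ).hasTemperateGrowth
  rw [SchwartzMap.laplacian_eq_sum (EuclideanSpace.basisFun (Fin 3) ℝ)]
  simp_rw [SchwartzMap.lineDerivOp_fourier_eq]
  simp only [Fin.sum_univ_three, ← FourierAdd.fourier_add]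
  congr 1
  ext ξ
  simp only [hin, add_apply, smul_apply, SchwartzMap.smulLeftCLM_apply_apply (hg 0),
    SchwartzMap.smulLeftCLM_apply_apply (hg 1), SchwartzMap.smulLeftCLM_apply_apply (hg 2),
    schwartzLaplacian_apply, laplacianSymbol,
    norm_sq_space, Complex.real_smul, smul_eq_mul]
  push_cast
  linear_combination (4 * Real.pi ^ 2 * ((ξ 0 : ℂ) ^ 2 + ξ 1 ^ 2 + ξ 2 ^ 2) * ψ ξ) * Complex.I_sq

/-- Transposing `y ∂ₓ` gives `-∂ₓ(y ·)`. Under `𝓕` the factors `2πi` from `y` and from `∂ₓ` cancel,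
so no power of `π` remains. -/
theorem shear_fourier (ψ : 𝓢(Space, ℂ)) :
    -∂_{ex} (SchwartzMap.smulLeftCLM ℂ (fun p : Space => ((p 1 : ℝ) : ℂ)) (𝓕 ψ)) =
      𝓕 (schwartzShear ψ) := by
  have hpi : (2 * Real.pi * Complex.I : ℂ) ≠ 0 := by
    simp [Real.pi_ne_zero]
  have hey : (fun ξ : Space => inner ℝ ξ ey) = fun ξ => ξ 1 := by
    ext ξ; simp [ey, EuclideanSpace.inner_single_right]
  have hex : (fun ξ : Space => inner ℝ ξ ex) = fun ξ => ξ 0 := by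
    ext ξ; simp [ex, EuclideanSpace.inner_single_right]
  have hg : ∀ i : Fin 3, (fun ξ : Space => ξ i).HasTemperateGrowth := fun i =>
    (EuclideanSpace.proj i : Space →L[ℝ] ℝ).hasTemperateGrowth
  have h1 : SchwartzMap.smulLeftCLM ℂ (fun p : Space => ((p 1 : ℝ) : ℂ)) (𝓕 ψ) =
      𝓕 ((2 * Real.pi * Complex.I : ℂ)⁻¹ • ∂_{ey} ψ) := by
    rw [FourierSMul.fourier_smul, SchwartzMap.fourier_lineDerivOp_eq, smul_smul,
      inv_mul_cancel₀ hpi, one_smul, hey]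
    ext ξ
    rw [SchwartzMap.smulLeftCLM_apply_apply (hasTemperateGrowth_coord 1),
      SchwartzMap.smulLeftCLM_apply_apply (hg 1), Complex.real_smul, smul_eq_mul]
  rw [h1, SchwartzMap.lineDerivOp_fourier_eq, hex, ← FourierTransform.fourier_neg]
  congr 1
  ext ξ
  simp only [neg_apply, smul_apply,
    SchwartzMap.smulLeftCLM_apply_apply (hg 0), schwartzShear_apply,
    SchwartzMap.lineDerivOp_apply_eq_fderiv, Complex.real_smul, smul_eq_mul]
  field_simp

theorem laplacianDistr_fourier (u : L2) (ψ : 𝓢(Space, ℂ)) :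
    laplacianDistr u (𝓕 ψ) = pairing ((schwartzLaplacian ψ).memLp 2) (𝓕 u) := by
  rw [← toDistr_fourier, ← laplacian_fourier]
  exact TemperedDistribution.laplacian_apply_apply _ _

theorem shearDistr_fourier (u : L2) (ψ : 𝓢(Space, ℂ)) :
    shearDistr u (𝓕 ψ) = pairing ((schwartzShear ψ).memLp 2) (𝓕 u) := by
  rw [← toDistr_fourier, ← shear_fourier]
  rfl

/-- Every Schwartz function is a Fourier transform, so it suffices to test against `𝓕 ψ`. -/
theorem toDistr_eq_iff (v : L2) (T : 𝓢'(Space, ℂ)) :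
    toDistr v = T ↔ ∀ ψ : 𝓢(Space, ℂ), pairing (ψ.memLp 2) (𝓕 v) = T (𝓕 ψ) := by
  constructor
  · rintro rfl ψ
    exact (toDistr_fourier v ψ).symm
  · intro h
    ext φ
    have := h (𝓕⁻ φ)
    rwa [← toDistr_fourier, FourierTransform.fourier_fourierInv_eq] at this

theorem mem_graph_scalarOp (ν : ℝ) (u w : L2) :
    (u, w) ∈ (scalarOp ν).graph ↔ ∃ v s : L2, toDistr v = laplacianDistr u ∧
      toDistr s = shearDistr u ∧ w = (ν : ℂ) • v - s := by
  rw [LinearPMap.mem_graph_iff]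
  constructor
  · rintro ⟨⟨z, hz⟩, rfl, hw⟩
    exact ⟨realization laplacianDistr ⟨z, hz.1⟩, realization shearDistr ⟨z, hz.2⟩,
      toDistr_realization _ _, toDistr_realization _ _, hw.symm⟩
  · rintro ⟨v, s, hv, hs, rfl⟩
    refine ⟨⟨u, ⟨v, hv⟩, ⟨s, hs⟩⟩, rfl, ?_⟩
    have h1 : realization laplacianDistr ⟨u, ⟨v, hv⟩⟩ = v :=
      toDistr_injective (by rw [toDistr_realization, hv])
    have h2 : realization shearDistr ⟨u, ⟨s, hs⟩⟩ = s :=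
      toDistr_injective (by rw [toDistr_realization, hs])
    change (ν : ℂ) • realization laplacianDistr ⟨u, ⟨v, hv⟩⟩ -
      realization shearDistr ⟨u, ⟨s, hs⟩⟩ = _
    rw [h1, h2]

/-- Tempered distributions are tested on Schwartz functions, the weak generator only on compactly
supported ones. The same cutoffs bridge the gap: their commutator with `ξ₀ ∂_{ξ₁}` is bounded
uniformly and tends to zero pointwise. -/
theorem integral_schwartz_of_integral_test {u s : L2}
    (h : ∀ φ, IsTest φ → ∫ ξ, φ ξ * s ξ = ∫ ξ, ((ξ 0 : ℂ) * fderiv ℝ φ ξ ey) * u ξ)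
    (ψ : 𝓢(Space, ℂ)) :
    ∫ ξ, ψ ξ * s ξ = ∫ ξ, schwartzShear ψ ξ * u ξ := by
  obtain ⟨C, hC⟩ := exists_bound_mul_deriv_bump
  set e : ℕ → ℝ := fun n => 1 / ((n : ℝ) + 1)
  have he : ∀ n : ℕ, 0 < e n := fun n => Nat.one_div_pos_of_nat
  have he0 : Tendsto e atTop (𝓝 0) := tendsto_one_div_add_atTop_nhds_zero_nat
  have hcut : ∀ ξ, Tendsto (fun n => (cutoff 1 (e n) ξ : ℂ)) atTop (𝓝 1) := fun ξ => by
    have h1 : Tendsto (fun n => e n * diffSymbol 1 ξ) atTop (𝓝 0) := by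
      simpa using he0.mul_const (diffSymbol 1 ξ)
    refine tendsto_const_nhds.congr' ?_
    filter_upwards [h1.eventually bump.eventuallyEq_one] with n hn
    have : cutoff 1 (e n) ξ = 1 := hn
    rw [this, Complex.ofReal_one]
  have hn := fun n => h _ (IsTest.of_schwartz_mul_cutoff one_pos (he n) ψ)
  have hfd : ∀ n ξ, fderiv ℝ (fun ξ => (cutoff 1 (e n) ξ : ℂ) * ψ ξ) ξ ey =
      (cutoff 1 (e n) ξ : ℂ) * fderiv ℝ ψ ξ ey +
        ((deriv bump (e n * diffSymbol 1 ξ) * (e n * (2 * 1 * ξ 1)) : ℝ) : ℂ) * ψ ξ := by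
    intro n ξ
    have hd := (contDiff_cutoff 1 (e n)).differentiable (by simp) ξ
    have hd2 : DifferentiableAt ℝ (fun η => (cutoff 1 (e n) η : ℂ)) ξ :=
      Complex.ofRealCLM.differentiableAt.comp ξ hd
    rw [fderiv_fun_mul hd2 ψ.differentiableAt]
    rw [← fderiv_ofReal_eq_of_hasLineDerivAt hd (hasLineDerivAt_cutoff 1 (e n) ξ)]
    simp [mul_comm]
  simp_rw [hfd] at hn
  have hcb : ∀ n ξ, ‖(cutoff 1 (e n) ξ : ℂ)‖ ≤ 1 := fun n ξ => by
    rw [Complex.norm_real, Real.norm_of_nonneg (cutoff_nonneg _ _ _)]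
    exact cutoff_le_one _ _ _
  have hcm : ∀ n, Continuous fun ξ => (cutoff 1 (e n) ξ : ℂ) := fun n =>
    Complex.continuous_ofReal.comp (contDiff_cutoff 1 (e n)).continuous
  have hlim1 : Tendsto (fun n => ∫ ξ, (cutoff 1 (e n) ξ : ℂ) * ψ ξ * s ξ) atTop
      (𝓝 (∫ ξ, ψ ξ * s ξ)) := by
    refine tendsto_integral_of_dominated_convergence (fun ξ => ‖ψ ξ * s ξ‖)
      (fun n => ((hcm n).mul ψ.continuous).aestronglyMeasurable.mul (Lp.aestronglyMeasurable s))
      ((ψ.memLp 2).integrable_mul (Lp.memLp s)).norm (fun n => ae_of_all _ fun ξ => ?_)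
      (ae_of_all _ fun ξ => ?_)
    · rw [mul_assoc, norm_mul]
      exact mul_le_of_le_one_left (norm_nonneg _) (hcb n ξ)
    · have := ((hcut ξ).mul_const (ψ ξ)).mul_const (s ξ)
      rwa [one_mul] at this
  have hlim2 : Tendsto (fun n => ∫ ξ, (ξ 0 : ℂ) * ((cutoff 1 (e n) ξ : ℂ) * fderiv ℝ ψ ξ ey +
        ((deriv bump (e n * diffSymbol 1 ξ) * (e n * (2 * 1 * ξ 1)) : ℝ) : ℂ) * ψ ξ) * u ξ) atTop
      (𝓝 (∫ ξ, schwartzShear ψ ξ * u ξ)) := by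
    have hdb : Continuous (deriv bump) := bump.contDiff.continuous_deriv (n := 1) le_rfl
    refine tendsto_integral_of_dominated_convergence
      (fun ξ => ‖schwartzShear ψ ξ * u ξ‖ + C * ‖ψ ξ * u ξ‖) (fun n => ?_) ?_
      (fun n => ae_of_all _ fun ξ => ?_) (ae_of_all _ fun ξ => ?_)
    · have h1 : Continuous fun ξ => fderiv ℝ ψ ξ ey :=
        ((ψ.smooth 1).continuous_fderiv (by simp)).clm_apply continuous_const
      have h2 := continuous_diffSymbol 1
      have h3 := ψ.continuous
      have h4 := hcm n
      refine Continuous.aestronglyMeasurable ?_ |>.mul (Lp.aestronglyMeasurable u)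
      fun_prop
    · exact (((schwartzShear ψ).memLp 2).integrable_mul (Lp.memLp u)).norm.add
        (((ψ.memLp 2).integrable_mul (Lp.memLp u)).norm.const_mul C)
    · have e1 : (ξ 0 : ℂ) * ((cutoff 1 (e n) ξ : ℂ) * fderiv ℝ ψ ξ ey +
          ((deriv bump (e n * diffSymbol 1 ξ) * (e n * (2 * 1 * ξ 1)) : ℝ) : ℂ) * ψ ξ) * u ξ =
          (cutoff 1 (e n) ξ : ℂ) * (schwartzShear ψ ξ * u ξ) +
          ((ξ 0 * (2 * 1 * ξ 1) * (e n * deriv bump (e n * diffSymbol 1 ξ)) : ℝ) : ℂ) *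
            (ψ ξ * u ξ) := by
        rw [schwartzShear_apply]
        push_cast
        ring
      rw [e1]
      refine (norm_add_le _ _).trans (add_le_add ?_ ?_)
      · rw [norm_mul]
        exact mul_le_of_le_one_left (norm_nonneg _) (hcb n ξ)
      · rw [norm_mul, Complex.norm_real, Real.norm_eq_abs, abs_mul]
        refine mul_le_mul_of_nonneg_right ?_ (norm_nonneg _)
        -- Replacing `|2ξ₀ξ₁|` by the symbol leaves exactly `|x bump'(x)|` at `x = e n * diffSymbol
        -- 1 ξ`.
        refine (mul_le_mul_of_nonneg_right (abs_mul_le_diffSymbol zero_le_one ξ)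
          (abs_nonneg _)).trans (le_trans (le_of_eq ?_) (hC (e n * diffSymbol 1 ξ)))
        rw [← abs_of_nonneg (diffSymbol_nonneg zero_le_one ξ), ← abs_mul,
          abs_of_nonneg (diffSymbol_nonneg zero_le_one ξ)]
        congr 1
        ring
    · have h1 : Tendsto (fun n => deriv bump (e n * diffSymbol 1 ξ) * (e n * (2 * 1 * ξ 1)))
          atTop (𝓝 0) := by
        have c1 : Continuous fun x : ℝ => deriv bump (x * diffSymbol 1 ξ) * (x * (2 * 1 * ξ 1)) := by
          fun_prop
        have := (c1.tendsto 0).comp he0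
        simpa [Function.comp_def] using this
      have h2 := (Complex.continuous_ofReal.tendsto 0).comp h1
      have h3 := ((((hcut ξ).mul_const (fderiv ℝ ψ ξ ey)).add
        (h2.mul_const (ψ ξ))).const_mul (ξ 0 : ℂ)).mul_const (u ξ)
      rw [schwartzShear_apply]
      simpa using h3
  exact tendsto_nhds_unique hlim1 (hlim2.congr fun n => (hn n).symm)

/-- The direction from the weak generator is the substantial one: the regularity estimate splits the
sum into two `L²` terms. -/
theorem mem_graph_scalarOp_iff {ν : ℝ} (hν : 0 < ν) (u w : L2) :
    (u, w) ∈ (scalarOp ν).graph ↔ IsWeakGen (4 * Real.pi ^ 2 * ν) (𝓕 u) (𝓕 w) := by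
  have hν' : (ν : ℂ) ≠ 0 := by exact_mod_cast hν.ne'
  have hF : ∀ v s : L2, 𝓕 ((ν : ℂ) • v - s) = (ν : ℂ) • 𝓕 v - 𝓕 s := fun v s => by
    change Lp.fourierTransformₗᵢ Space ℂ _ = _
    rw [map_sub, map_smul]
    rfl
  have hgen : ∀ (ψ : 𝓢(Space, ℂ)) (a : L2),
      ∫ ξ, dualGen (4 * Real.pi ^ 2 * ν) ψ ξ * a ξ =
        ν * pairing ((schwartzLaplacian ψ).memLp 2) a - pairing ((schwartzShear ψ).memLp 2) a := by
    intro ψ a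
    rw [pairing_apply, pairing_apply, ← integral_const_mul, ← integral_sub]
    · simp_rw [dualGen_schwartz]
      refine integral_congr_ae (ae_of_all _ fun ξ => ?_)
      simp only [Pi.sub_apply, Pi.smul_apply, smul_eq_mul]
      ring
    · exact (((schwartzLaplacian ψ).memLp 2).integrable_mul (Lp.memLp a)).const_mul _
    · exact ((schwartzShear ψ).memLp 2).integrable_mul (Lp.memLp a)
  rw [mem_graph_scalarOp]
  constructor
  · rintro ⟨v, s, hv, hs, rfl⟩ φ hφ
    set ψ : 𝓢(Space, ℂ) := hφ.2.toSchwartzMap hφ.1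
    rw [toDistr_eq_iff] at hv hs
    have h1 := hv ψ
    have h2 := hs ψ
    rw [laplacianDistr_fourier] at h1
    rw [shearDistr_fourier] at h2
    change ∫ ξ, ψ ξ * _ = ∫ ξ, dualGen _ ψ ξ * _
    rw [hgen, ← pairing_apply (ψ.memLp 2), hF, map_sub, map_smul, h1, h2, smul_eq_mul]
  · intro h
    -- The factor `-ν⁻¹` turns `4π²ν|ξ|²` into the Laplacian symbol `-4π²|ξ|²`.
    have hq := (h.memLp_diffSymbol_mul (by positivity)).const_mul (-(ν : ℂ)⁻¹)
    set v : L2 := 𝓕⁻ (hq.toLp) with hv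
    have hFv : 𝓕 v = hq.toLp := FourierTransform.fourier_fourierInv_eq _
    have hpv : ∀ ψ : 𝓢(Space, ℂ), pairing (ψ.memLp 2) (𝓕 v) =
        pairing ((schwartzLaplacian ψ).memLp 2) (𝓕 u) := by
      intro ψ
      rw [hFv, pairing_apply, pairing_apply]
      refine integral_congr_ae ?_
      filter_upwards [hq.coeFn_toLp] with ξ h1
      rw [h1, schwartzLaplacian_apply, laplacianSymbol, norm_sq_space, diffSymbol]
      push_cast
      field_simp
    refine ⟨v, (ν : ℂ) • v - w, ?_, ?_, by abel⟩
    · rw [toDistr_eq_iff]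
      intro ψ
      rw [laplacianDistr_fourier, hpv]
    · rw [toDistr_eq_iff]
      intro ψ
      rw [shearDistr_fourier, pairing_apply, pairing_apply]
      refine integral_schwartz_of_integral_test (fun φ hφ => ?_) ψ
      set χ : 𝓢(Space, ℂ) := hφ.2.toSchwartzMap hφ.1
      have h1 : ∫ ξ, ((ξ 0 : ℂ) * fderiv ℝ φ ξ ey) * (𝓕 u : L2) ξ =
          pairing ((schwartzShear χ).memLp 2) (𝓕 u) := by
        rw [pairing_apply]
        simp_rw [schwartzShear_apply]
        rfl
      have h2 : pairing (χ.memLp 2) (𝓕 w) = ∫ ξ, dualGen (4 * Real.pi ^ 2 * ν) χ ξ * (𝓕 u : L2) ξ :=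
        (pairing_apply _ _).trans (h φ hφ)
      rw [h1, hF]
      change ∫ ξ, χ ξ * _ = _
      rw [← pairing_apply (χ.memLp 2), map_sub, map_smul, h2, hgen, hpv, smul_eq_mul]
      ring

/-! ### The system -/

theorem tendsto_L2Vec {α : Type*} {l : Filter α} {F : α → L2Vec} {u : L2Vec} :
    Tendsto F l (𝓝 u) ↔ ∀ i, Tendsto (fun a => F a i) l (𝓝 (u i)) := by
  rw [← tendsto_pi_nhds]
  constructor
  · intro h
    exact ((PiLp.continuous_ofLp 2 (fun _ : Fin 3 => L2)).tendsto u).comp h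
  · intro h
    exact ((PiLp.continuous_toLp 2 (fun _ : Fin 3 => L2)).tendsto u.ofLp).comp h

/-- The semigroup on `L²` conjugated by the Fourier transform, acting on each component. -/
def vecOp (T : L2 →L[ℂ] L2) : L2Vec →L[ℂ] L2Vec where
  toFun u := WithLp.toLp 2 fun i => 𝓕⁻ (T (𝓕 (u i)) : L2)
  map_add' u v := by
    ext1 i
    change (Lp.fourierTransformₗᵢ Space ℂ).symm (T (Lp.fourierTransformₗᵢ Space ℂ (u i + v i))) = _
    rw [map_add, map_add, map_add]; rfl
  map_smul' c u := by
    ext1 i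
    change (Lp.fourierTransformₗᵢ Space ℂ).symm (T (Lp.fourierTransformₗᵢ Space ℂ (c • u i))) = _
    rw [map_smul, map_smul, map_smul]; rfl
  cont := (PiLp.continuous_toLp 2 _).comp <| continuous_pi fun i =>
    (Lp.fourierTransformₗᵢ Space ℂ).symm.continuous.comp <| T.continuous.comp <|
      (Lp.fourierTransformₗᵢ Space ℂ).continuous.comp <| PiLp.continuous_apply 2 _ i

theorem vecOp_apply (T : L2 →L[ℂ] L2) (u : L2Vec) (i : Fin 3) :
    vecOp T u i = 𝓕⁻ (T (𝓕 (u i)) : L2) := rfl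

theorem norm_fourierInv_L2 (v : L2) : ‖(𝓕⁻ v : L2)‖ = ‖v‖ :=
  (Lp.fourierTransformₗᵢ Space ℂ).symm.norm_map v

theorem tendsto_fourier_iff {α : Type*} {l : Filter α} {F : α → L2} {v : L2} :
    Tendsto (fun a => (𝓕 (F a) : L2)) l (𝓝 (𝓕 v)) ↔ Tendsto F l (𝓝 v) :=
  (Lp.fourierTransformₗᵢ Space ℂ).toHomeomorph.isInducing.tendsto_nhds_iff.symm

/-- The semigroup generated by the diagonal part. -/
def diagSemigroup {c : ℝ} (hc : 0 ≤ c) : C0Semigroup L2Vec where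
  op t := vecOp ((fourierSemigroup hc).op t)
  op_zero := by
    ext1 u
    ext1 i
    rw [vecOp_apply, C0Semigroup.op_zero_apply, FourierTransform.fourierInv_fourier_eq]
    rfl
  op_add s t := by
    ext1 u
    ext1 i
    change _ = vecOp _ (vecOp _ u) i
    rw [vecOp_apply, vecOp_apply, vecOp_apply, FourierTransform.fourier_fourierInv_eq,
      C0Semigroup.op_add_apply]
  tendsto_op u := by
    refine tendsto_L2Vec.2 fun i => tendsto_fourier_iff.1 ?_
    simp only [vecOp_apply, FourierTransform.fourier_fourierInv_eq]
    exact (fourierSemigroup hc).tendsto_op _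

theorem isContraction_diagSemigroup {c : ℝ} (hc : 0 ≤ c) : (diagSemigroup hc).IsContraction := by
  intro t u
  refine (sq_le_sq₀ (norm_nonneg _) (norm_nonneg _)).1 ?_
  rw [PiLp.norm_sq_eq_of_L2, PiLp.norm_sq_eq_of_L2]
  refine Finset.sum_le_sum fun i _ => pow_le_pow_left₀ (norm_nonneg _) ?_ 2
  change ‖vecOp _ u i‖ ≤ _
  rw [vecOp_apply, norm_fourierInv_L2, ← Lp.norm_fourier_eq (u i)]
  exact isContraction_fourierSemigroup hc t _

theorem mem_graph_diagOp (A : L2 →ₗ.[ℂ] L2) (u w : L2Vec) :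
    (u, w) ∈ (diagOp A).graph ↔ ∀ i, (u i, w i) ∈ A.graph := by
  simp only [LinearPMap.mem_graph_iff]
  constructor
  · rintro ⟨z, rfl, rfl⟩ i
    exact ⟨⟨z.1 i, z.2 i⟩, rfl, rfl⟩
  · intro h
    choose z hz1 hz2 using h
    have hu : ∀ i, u i ∈ A.domain := fun i => hz1 i ▸ (z i).2
    refine ⟨⟨u, hu⟩, rfl, ?_⟩
    ext1 i
    rw [← hz2 i]
    exact congrArg A (Subtype.ext (hz1 i).symm)

theorem diagSemigroup_isGeneratedBy {ν : ℝ} (hν : 0 < ν)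
    (hc : 0 ≤ 4 * Real.pi ^ 2 * ν) :
    (diagSemigroup hc).IsGeneratedBy (diagOp (scalarOp ν)) := by
  intro u w
  rw [mem_graph_diagOp, tendsto_L2Vec]
  refine forall_congr' fun i => ?_
  rw [mem_graph_scalarOp_iff hν, ← tendsto_iff_isWeakGen hc]
  refine Iff.trans (tendsto_congr fun t => ?_) tendsto_fourier_iff
  change _ = Lp.fourierTransformₗᵢ Space ℂ (((t : ℝ)⁻¹ : ℂ) •
    ((Lp.fourierTransformₗᵢ Space ℂ).symm _ - u i))
  rw [map_smul, map_sub, LinearIsometryEquiv.apply_symm_apply]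
  rfl

theorem isClosed_graph_scalarOp {ν : ℝ} (hν : 0 < ν) :
    IsClosed ((scalarOp ν).graph : Set (L2 × L2)) := by
  have h : ((scalarOp ν).graph : Set (L2 × L2)) =
      (fun p : L2 × L2 => ((𝓕 p.1 : L2), (𝓕 p.2 : L2))) ⁻¹'
        {p | IsWeakGen (4 * Real.pi ^ 2 * ν) p.1 p.2} := by
    ext p
    exact mem_graph_scalarOp_iff hν p.1 p.2
  rw [h]
  have hF : Continuous fun v : L2 => (𝓕 v : L2) := (Lp.fourierTransformₗᵢ Space ℂ).continuous
  exact (isClosed_setOf_isWeakGen _).preimage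
    ((hF.comp continuous_fst).prodMk (hF.comp continuous_snd))

/-- A matrix of bounded operators as a bounded operator. -/
def matrixCLM (M : Matrix (Fin 3) (Fin 3) (L2 →L[ℂ] L2)) : L2Vec →L[ℂ] L2Vec where
  toLinearMap := matrixOp M
  cont := (PiLp.continuous_toLp 2 _).comp <| continuous_pi fun i =>
    continuous_finsetSum _ fun j _ => (M i j).continuous.comp <| PiLp.continuous_apply 2 _ j

theorem mem_graph_linOp (ν f : ℝ) (u w : L2Vec) :
    (u, w) ∈ (linOp ν f).graph ↔
      (u, w - matrixCLM (lowerMatrix f) u) ∈ (diagOp (scalarOp ν)).graph :=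
  C0Semigroup.mem_graph_vadd (matrixCLM (lowerMatrix f)) u w

/-- A point is in the graph when each component, after subtracting the bounded part, is in the
closed scalar graph; these conditions are continuous in the point. -/
theorem isClosed_linOp {ν : ℝ} (hν : 0 < ν) (f : ℝ) : (linOp ν f).IsClosed := by
  have h : ((linOp ν f).graph : Set (L2Vec × L2Vec)) = ⋂ i : Fin 3,
      (fun p : L2Vec × L2Vec => (p.1 i, (p.2 - matrixCLM (lowerMatrix f) p.1) i)) ⁻¹'
        ((scalarOp ν).graph : Set (L2 × L2)) := by
    ext p
    rw [Set.mem_iInter]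
    exact (mem_graph_linOp ν f p.1 p.2).trans (mem_graph_diagOp _ _ _)
  rw [LinearPMap.IsClosed, h]
  refine isClosed_iInter fun i => (isClosed_graph_scalarOp hν).preimage ?_
  exact ((PiLp.continuous_apply 2 _ i).comp continuous_fst).prodMk
    ((PiLp.continuous_apply 2 _ i).comp
      (continuous_snd.sub ((matrixCLM (lowerMatrix f)).continuous.comp continuous_fst)))

end CouetteCoriolis

end

theorem mainTheorem5 (ν f : ℝ) (hν : 0 < ν) :
    (CouetteCoriolis.linOp ν f).IsClosed ∧
      ∃ S : CouetteCoriolis.C0Semigroup CouetteCoriolis.L2Vec,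
        S.IsGeneratedBy (CouetteCoriolis.linOp ν f) :=
  ⟨CouetteCoriolis.isClosed_linOp hν f,
    (CouetteCoriolis.isContraction_diagSemigroup (by positivity)).exists_isGeneratedBy_vadd
      (CouetteCoriolis.matrixCLM (CouetteCoriolis.lowerMatrix f))
      (CouetteCoriolis.diagSemigroup_isGeneratedBy hν (by positivity))⟩
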